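/- Let $\Omega\subseteq\mathbb R^n$ be a non-empty open convex set, $T_\Omega=\mathbb R^n+i\Omega\subseteq\mathbb C^n$, and write $\Omega'\Subset\Omega$ if $\overline{\Omega'}$ is compact and contained in $\Omega$. A holomorphic mapping $F=(f_1,\dots,f_m):T_\Omega\to\mathbb C^m$ is almost periodic if for all $\varepsilon>0$ and $\Omega'\Subset\Omega$ there are $t_1,\dots,t_n>0$ such that every box $\{x\in\mathbb R^n:|x_k-\xi_k|<t_k,\ 1\le k\le n\}$, $\xi\in\mathbb R^n$, contains a point $\tau$ with $\sup_{z\in T_{\Omega'}}\max_\ell|f_\ell(z+\tau)-f_\ell(z)|<\varepsilon$. Let $HAP(T_\Omega,\mathbb C^m)$ be the space of these mappings, with the topology $\tau(T_\Omega)$ of uniform convergence on every subtube $T_{\Omega'}$, $\Omega'\Subset\Omega$. The Bochner transform of $F$ is $\mathcal B(F)=\{F(\cdot+t):t\in\mathbb R^n\}$, and $\overline{\mathcal B(F)}$ is its closure in $HAP(T_\Omega,\mathbb C^m)$. With $\langle z,\lambda\rangle=\sum_k z_k\lambda_k$, let $$a(\lambda,f)=\lim_{s\to+\infty}\frac1{(2s)^n}\int_{|x_1|,\dots,|x_n|<s}e^{-i\langle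 x+iy,\lambda\rangle}f(x+iy)\,dx\qquad(\lambda\in\mathbb R^n)$$ be the Bohr transform of a scalar holomorphic almost periodic function $f$ (it does not depend on $y\in\Omega$), and let $\mathrm{Sp} f=\{\lambda:a(\lambda,f)\neq0\}$. Let $L_F$ be the $\mathbb Q$-linear subspace of $\mathbb R^n$ generated by $\bigcup_\ell\mathrm{Sp} f_\ell$. For a finite or infinite sequence $(\omega_r)_{r\ge1}$ that is a $\mathbb Q$-basis of $L_F$, the Bochner–Fejér approximation $Q_j(F)=(Q_j(f_1),\dots,Q_j(f_m))$, $j\in\mathbb N$, is given by $$Q_j(f)(z)=\sum_{\nu}\ \prod_{r}\Big(1-\frac{|\nu_r|}{(j!)^2}\Big)\ a\Big(\sum_{r}\nu_r\frac{\omega_r}{j!},f\Big)\,\exp\Big(i\sum_{r}\nu_r\big\langle z,\tfrac{\omega_r}{j!}\big\rangle\Big),$$ where $r$ runs over the indices $r\le j$ of the basis and $\nu=(\nu_r)$ over the tuples of integers with $|\nu_r|\le(j!)^2$. Let $\mathrm{Ch}\,\mathbb R^n$ be the group of all (not necessarily continuous) homomorphisms $\chi:\mathbb R^n\to\mathbb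 S^1$. If the components $e_\ell$ of $E$ are finite $\mathbb C$-linear combinations of exponentials $e^{i\langle z,\lambda\rangle}$, $\lambda\in\mathbb R^n$, let $E_\chi$ be the mapping with components $\sum_{\lambda\in\mathrm{Sp} e_\ell}a(\lambda,e_\ell)\chi(\lambda)e^{i\langle z,\lambda\rangle}$. For $F\in HAP(T_\Omega,\mathbb C^m)$ let $F_\chi=\lim_{j\to\infty}(Q_j(F))_\chi$ in the topology $\tau(T_\Omega)$, and let $\mathcal O(F)=\{F_\chi:\chi\in\mathrm{Ch}\,\mathbb R^n\}$ be the orbit of $F$. **Theorem.** Let $F\in HAP(T_\Omega,\mathbb C^m)$. Then $F_\chi$ is well defined for every $\chi\in\mathrm{Ch}\,\mathbb R^n$, that is, $L_F$ has a finite or infinite sequence as a basis, the limit exists in $HAP(T_\Omega,\mathbb C^m)$ for every such basis, and it does not depend on the basis. Moreover $$\mathcal O(F)=\overline{\mathcal B(F)}.$$ -/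

import Mathlib

namespace TubeAP

open Filter Topology MeasureTheory

noncomputable section

/-- The horizontal tube `T_Ω = ℝⁿ + iΩ ⊆ ℂⁿ` on the base `Ω ⊆ ℝⁿ`. -/
def tube {n : ℕ} (Ω : Set (Fin n → ℝ)) : Set (Fin n → ℂ) :=
  {z | (fun k => (z k).im) ∈ Ω}

/-- The point `x + iy` of the tube `T_Ω`, for `x ∈ ℝⁿ` and `y ∈ Ω`. -/
def tubePoint {n : ℕ} {Ω : Set (Fin n → ℝ)} (x : Fin n → ℝ) (y : Ω) : tube Ω :=
  ⟨fun k => (x k : ℂ) + Complex.I * (y.1 k : ℂ), by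
    have h : (fun k => ((x k : ℂ) + Complex.I * (y.1 k : ℂ)).im) = y.1 := by
      funext k; simp
    show (fun k => ((x k : ℂ) + Complex.I * (y.1 k : ℂ)).im) ∈ Ω
    rw [h]; exact y.2⟩

/-- The horizontal translation `z ↦ z + t` of the tube, for `t ∈ ℝⁿ`. -/
def shift {n : ℕ} {Ω : Set (Fin n → ℝ)} (t : Fin n → ℝ) (z : tube Ω) : tube Ω :=
  ⟨fun k => z.1 k + (t k : ℂ), by
    have h : (fun k => (z.1 k + (t k : ℂ)).im) = fun k => (z.1 k).im := by
      funext k; simp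
    show (fun k => (z.1 k + (t k : ℂ)).im) ∈ Ω
    rw [h]; exact z.2⟩

/-- The bilinear pairing `⟨z, μ⟩ = ∑ zₖ μₖ` of `z ∈ ℂⁿ` and `μ ∈ ℝⁿ`. -/
def pairing {n : ℕ} (z : Fin n → ℂ) (μ : Fin n → ℝ) : ℂ :=
  ∑ k, z k * (μ k : ℂ)

/-- `Ω' ⋐ Ω`: the closure of `Ω'` is compact and contained in `Ω`. -/
def CompactlyIn {n : ℕ} (Ω' Ω : Set (Fin n → ℝ)) : Prop :=
  IsCompact (closure Ω') ∧ closure Ω' ⊆ Ω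

/-- The subtube `T_{Ω'}`, as a subset of the tube `T_Ω`. -/
def subtube {n : ℕ} (Ω Ω' : Set (Fin n → ℝ)) : Set (tube Ω) :=
  {z | z.1 ∈ tube Ω'}

/-- The family of all subtubes `T_{Ω'}` with `Ω' ⋐ Ω`. -/
def subtubes {n : ℕ} (Ω : Set (Fin n → ℝ)) : Set (Set (tube Ω)) :=
  {S | ∃ Ω' : Set (Fin n → ℝ), CompactlyIn Ω' Ω ∧ S = subtube Ω Ω'}

/-- All mappings `T_Ω → ℂᵐ`, with the topology of uniform convergence on every subtube
`T_{Ω'}`, `Ω' ⋐ Ω`. -/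
abbrev TubeMap {n : ℕ} (Ω : Set (Fin n → ℝ)) (m : ℕ) : Type :=
  UniformOnFun (tube Ω) (Fin m → ℂ) (subtubes Ω)

/-- The `l`-th component of a mapping `T_Ω → ℂᵐ`. -/
def component {n m : ℕ} {Ω : Set (Fin n → ℝ)} (F : TubeMap Ω m) (l : Fin m) :
    tube Ω → ℂ :=
  fun z => UniformOnFun.toFun (subtubes Ω) F z l

/-- Holomorphy of a mapping on the (open) tube. -/
def IsHolomorphic {n m : ℕ} {Ω : Set (Fin n → ℝ)} (F : TubeMap Ω m) : Prop :=
  ∃ g : (Fin n → ℂ) → (Fin m → ℂ), DifferentiableOn ℂ g (tube Ω) ∧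
    ∀ z : tube Ω, g z.1 = UniformOnFun.toFun (subtubes Ω) F z

/-- Almost periodicity: for every `ε > 0` and `Ω' ⋐ Ω` there are side lengths `t₁, …, tₙ > 0`
such that every box with centre `ξ` and half sides `t₁, …, tₙ` contains an `ε`-almost period
on `T_{Ω'}`. -/
def IsAlmostPeriodic {n m : ℕ} {Ω : Set (Fin n → ℝ)} (F : TubeMap Ω m) : Prop :=
  ∀ ε : ℝ, 0 < ε → ∀ Ω' : Set (Fin n → ℝ), CompactlyIn Ω' Ω →
    ∃ t : Fin n → ℝ, (∀ k, 0 < t k) ∧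
      ∀ ξ : Fin n → ℝ, ∃ τ : Fin n → ℝ, (∀ k, |τ k - ξ k| < t k) ∧
        ∃ δ : ℝ, δ < ε ∧ ∀ z ∈ subtube Ω Ω', ∀ l : Fin m,
          ‖component F l (shift τ z) - component F l z‖ ≤ δ

/-- The space `HAP(T_Ω, ℂᵐ)` of holomorphic almost periodic mappings, with the topology of
uniform convergence on the subtubes `T_{Ω'}`, `Ω' ⋐ Ω`. -/
abbrev HAP {n : ℕ} (Ω : Set (Fin n → ℝ)) (m : ℕ) : Type :=
  {F : TubeMap Ω m // IsHolomorphic F ∧ IsAlmostPeriodic F}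

/-- The translate `z ↦ F(z + t)` of a mapping on the tube. -/
def translateMap {n m : ℕ} {Ω : Set (Fin n → ℝ)} (t : Fin n → ℝ) (F : TubeMap Ω m) :
    TubeMap Ω m :=
  UniformOnFun.ofFun (subtubes Ω) fun z => UniformOnFun.toFun (subtubes Ω) F (shift t z)

theorem shift_shift_comm {n : ℕ} {Ω : Set (Fin n → ℝ)} (s t : Fin n → ℝ) (z : tube Ω) :
    shift s (shift t z) = shift t (shift s z) := by
  apply Subtype.ext
  funext k
  simp only [shift]
  ring

theorem shift_mem_subtube {n : ℕ} {Ω Ω' : Set (Fin n → ℝ)} (t : Fin n → ℝ) {z : tube Ω}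
    (hz : z ∈ subtube Ω Ω') : shift t z ∈ subtube Ω Ω' := by
  have h : (fun k => (z.1 k + (t k : ℂ)).im) = fun k => (z.1 k).im := by
    funext k; simp
  show (fun k => (z.1 k + (t k : ℂ)).im) ∈ Ω'
  rw [h]; exact hz

theorem isHolomorphic_translateMap {n m : ℕ} {Ω : Set (Fin n → ℝ)} (t : Fin n → ℝ)
    {F : TubeMap Ω m} (hF : IsHolomorphic F) : IsHolomorphic (translateMap t F) := by
  obtain ⟨g, hg, hgF⟩ := hF
  refine ⟨fun z => g (z + fun k => (t k : ℂ)), ?_, fun z => hgF (shift t z)⟩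
  refine hg.comp (differentiable_id.add_const _).differentiableOn ?_
  intro z hz
  exact (shift t (⟨z, hz⟩ : tube Ω)).2

theorem isAlmostPeriodic_translateMap {n m : ℕ} {Ω : Set (Fin n → ℝ)} (t : Fin n → ℝ)
    {F : TubeMap Ω m} (hF : IsAlmostPeriodic F) : IsAlmostPeriodic (translateMap t F) := by
  intro ε hε Ω' hΩ'
  obtain ⟨b, hb, h⟩ := hF ε hε Ω' hΩ'
  refine ⟨b, hb, fun ξ => ?_⟩
  obtain ⟨τ, hτ, δ, hδ, hd⟩ := h ξ
  refine ⟨τ, hτ, δ, hδ, fun z hz l => ?_⟩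
  have := hd (shift t z) (shift_mem_subtube t hz) l
  rw [shift_shift_comm] at this
  exact this

/-- The translate `F(· + t)` as an element of `HAP(T_Ω, ℂᵐ)`. -/
def translate {n m : ℕ} {Ω : Set (Fin n → ℝ)} (t : Fin n → ℝ) (F : HAP Ω m) : HAP Ω m :=
  ⟨translateMap t F.1, isHolomorphic_translateMap t F.2.1,
    isAlmostPeriodic_translateMap t F.2.2⟩

/-- The Bochner transform `{F(· + t) : t ∈ ℝⁿ}` of `F`, a subset of `HAP(T_Ω, ℂᵐ)`. -/
def bochnerTransform {n m : ℕ} {Ω : Set (Fin n → ℝ)} (F : HAP Ω m) : Set (HAP Ω m) :=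
  Set.range fun t : Fin n → ℝ => translate t F

/-- The average
`(2s)⁻ⁿ ∫_{|x₁| < s, …, |xₙ| < s} exp(-i⟨x + iy, μ⟩) f(x + iy) dx`. -/
def bohrMean {n : ℕ} {Ω : Set (Fin n → ℝ)} (f : tube Ω → ℂ) (μ : Fin n → ℝ) (y : Ω)
    (s : ℝ) : ℂ :=
  ((((2 * s) ^ n)⁻¹ : ℝ) : ℂ) *
    ∫ x in {x : Fin n → ℝ | ∀ k, |x k| < s},
      Complex.exp (-(Complex.I * pairing (tubePoint x y).1 μ)) * f (tubePoint x y)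

/-- `c` is the Bohr coefficient of `f` at the frequency `μ`: the averages converge to `c`,
whatever `y ∈ Ω`. -/
def HasBohrCoeff {n : ℕ} {Ω : Set (Fin n → ℝ)} (f : tube Ω → ℂ) (μ : Fin n → ℝ) (c : ℂ) :
    Prop :=
  ∀ y : Ω, Tendsto (fun s : ℝ => bohrMean f μ y s) atTop (𝓝 c)

open Classical in
/-- The Bohr transform `a(μ, f)` (set to `0` where the coefficient does not exist, which does
not happen for components of elements of `HAP`). -/
def bohr {n : ℕ} {Ω : Set (Fin n → ℝ)} (f : tube Ω → ℂ) (μ : Fin n → ℝ) : ℂ :=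
  if h : ∃ c, HasBohrCoeff f μ c then h.choose else 0

/-- The spectrum `Sp f = {μ ∈ ℝⁿ : a(μ, f) ≠ 0}`. -/
def bohrSpectrum {n : ℕ} {Ω : Set (Fin n → ℝ)} (f : tube Ω → ℂ) : Set (Fin n → ℝ) :=
  {μ | bohr f μ ≠ 0}

/-- The `ℚ`-linear subspace of `ℝⁿ` generated by the spectra of the components of `F`. -/
def spectralSpan {n m : ℕ} {Ω : Set (Fin n → ℝ)} (F : TubeMap Ω m) :
    Submodule ℚ (Fin n → ℝ) :=
  Submodule.span ℚ (⋃ l : Fin m, bohrSpectrum (component F l))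

open Classical in
/-- The indices among the first `j` ones; `I ⊆ ℕ` is the index set of a basis. -/
def firstIndices (I : Set ℕ) (j : ℕ) : Finset I :=
  (Finset.range j).subtype (fun r => r ∈ I)

open Classical in
/-- The tuples of integers `(ν_r)`, `r` among the first `j` indices, with `|ν_r| ≤ (j!)²`. -/
def fejerTuples (I : Set ℕ) (j : ℕ) : Finset (firstIndices I j → ℤ) :=
  Fintype.piFinset fun _ => Finset.Icc (-((j.factorial : ℤ) ^ 2)) ((j.factorial : ℤ) ^ 2)

/-- The frequency `∑_r ν_r (ω_r / j!)`. -/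
def fejerFrequency {n : ℕ} {I : Set ℕ} (ω : I → (Fin n → ℝ)) (j : ℕ)
    (ν : firstIndices I j → ℤ) : Fin n → ℝ :=
  ∑ r, ((ν r : ℝ) / (j.factorial : ℝ)) • ω r.1

/-- The Bochner-Fejer exponential sum
`Q_j(f)(z) = ∑_ν ∏_r (1 - |ν_r| / (j!)²) a(∑_r ν_r ω_r / j!, f) exp(i ∑_r ν_r ⟨z, ω_r / j!⟩)`. -/
def fejerSum {n : ℕ} {Ω : Set (Fin n → ℝ)} {I : Set ℕ} (ω : I → (Fin n → ℝ)) (j : ℕ)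
    (f : tube Ω → ℂ) : tube Ω → ℂ :=
  fun z => ∑ ν ∈ fejerTuples I j,
    ((∏ r, (1 - |(ν r : ℝ)| / (j.factorial : ℝ) ^ 2) : ℝ) : ℂ) *
      bohr f (fejerFrequency ω j ν) *
      Complex.exp (Complex.I * pairing z.1 (fejerFrequency ω j ν))

/-- The Bochner-Fejer approximation `Q_j(F) = (Q_j(f_1), …, Q_j(f_m))`. -/
def bochnerFejer {n m : ℕ} {Ω : Set (Fin n → ℝ)} {I : Set ℕ} (ω : I → (Fin n → ℝ)) (j : ℕ)
    (F : TubeMap Ω m) : TubeMap Ω m :=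
  UniformOnFun.ofFun (subtubes Ω) fun z l => fejerSum ω j (component F l) z

/-- The perturbation by the character `χ` of a mapping `E` whose components are exponential
sums: `(e_l)_χ(z) = ∑_{μ ∈ Sp e_l} a(μ, e_l) χ(μ) exp(i⟨z, μ⟩)`, a finite sum. Elements of
`AddChar (Fin n → ℝ) Circle` are arbitrary homomorphisms `ℝⁿ → 𝕊¹`, no continuity is required. -/
def perturbExp {n m : ℕ} {Ω : Set (Fin n → ℝ)} (χ : AddChar (Fin n → ℝ) Circle)
    (E : TubeMap Ω m) : TubeMap Ω m :=
  UniformOnFun.ofFun (subtubes Ω) fun z l =>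
    ∑ᶠ (μ : Fin n → ℝ) (_ : μ ∈ bohrSpectrum (component E l)),
      bohr (component E l) μ * (χ μ : ℂ) * Complex.exp (Complex.I * pairing z.1 μ)

/-- `G` is the perturbation `F_χ` of `F ∈ HAP(T_Ω, ℂᵐ)` by the character `χ`, that is,
`(Q_j(F))_χ → G` uniformly on every `T_{Ω'}`, `Ω' ⋐ Ω`, where `Q_j(F)` is the Bochner-Fejer
approximation with respect to any `ℚ`-basis `(ω_r)` of the spectral span of `F` that is finite,
`ω_0, …, ω_{d-1}`, or an infinite sequence (i.e. indexed by an initial segment of `ℕ`). -/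
def IsPerturbation {n m : ℕ} {Ω : Set (Fin n → ℝ)} (F : HAP Ω m)
    (χ : AddChar (Fin n → ℝ) Circle) (G : HAP Ω m) : Prop :=
  ∀ (I : Set ℕ), IsLowerSet I → ∀ ω : Module.Basis I ℚ (spectralSpan F.1),
    Tendsto (fun j : ℕ => perturbExp χ (bochnerFejer (fun r => (ω r : Fin n → ℝ)) j F.1))
      atTop (𝓝 G.1)

/-- The orbit `𝒪(F) = {F_χ : χ ∈ Ch ℝⁿ}`. -/
def orbit {n m : ℕ} {Ω : Set (Fin n → ℝ)} (F : HAP Ω m) : Set (HAP Ω m) :=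
  {G | ∃ χ : AddChar (Fin n → ℝ) Circle, IsPerturbation F χ G}

end

end TubeAP

/-!
# Perturbations and translates of holomorphic almost periodic mappings

For `t ∈ ℝⁿ` let `phase t` be the continuous character `μ ↦ exp(i⟨t, μ⟩)` of `ℝⁿ`. The translate
of an exponential sum by `t` is its perturbation by `phase t`, so the theorem says that nothing but
limits of these perturbations arises when all characters are admitted. Three facts make this work.

* **Kronecker's theorem** (`exists_filter_tendsto_phase`): every character `χ` is the pointwise
  limit of `phase t` along a filter of `t`'s. Conversely, the group of all characters is compact
  (`exists_addChar_tendsto`), so along every ultrafilter of `t`'s the `phase t` converge to some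
  character.
* **The approximation theorem** (`IsHolomorphicAP.exists_expSum_near`): on each subtube, `F` is a
  uniform limit of exponential sums `P` with frequencies in its spectrum. Hence the spectrum is
  countable, and the Bochner-Fejér sums, being averages of translates of `F` against a nonnegative
  kernel of mean one, are eventually as close to `P` as `F` is (up to a factor `2`).
* **Contraction** (`norm_expSum_modulate_le`): perturbing an exponential sum does not increase its
  supremum on a subtube.

So if `phase t → χ` along a filter, both the translates of `F` and the perturbed Bochner-Fejér sums
end up close to the perturbation of `P` by `χ`. Both therefore converge, to the same limit
`F_χ`, whatever the basis (`exists_isPerturbation_of_tendsto_phase`). This gives existence and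
`𝒪(F) ⊆ closure ℬ(F)`. For the other inclusion, an element of the closure is a limit of translates
along an ultrafilter, and the limit of the `phase t` along it is the required character.

The approximation theorem is proved without harmonic analysis on the Bohr compactification. The
almost periods of `F` are relatively dense, so by **Bogolyubov's theorem**
(`exists_bohr_set_of_relatively_dense`), which is reduced to finite Fourier analysis on
`(ℤ/N)ⁿ`, sums of four of them, with signs, fill a Bohr neighbourhood
`{τ : |exp(i⟨τ, μ⟩) - 1| < δ, μ ∈ Λ}` up to a small error, and that neighbourhood consists of almost
periods (`IsHolomorphicAP.exists_bohr_set`). Averaging translates of `F` against a Fejér kernel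
concentrated on it yields the approximating sum. The averages are taken in the mean along an
ultrafilter, which exists for all bounded functions; the existence of the Bohr coefficients as honest
limits is a consequence of the approximation, not an ingredient. That the coefficients do not depend
on the imaginary part (`mean_eq_of_mem_tube`) is where holomorphy enters.
-/

namespace TubeAP

open Filter Topology MeasureTheory

noncomputable section

/-! ### Bogolyubov's theorem -/

/-- **Bogolyubov's lemma** in a finite abelian group: if `A` has density at least `α`, then
`A + A - A - A` contains every point at which boundedly many characters have nonnegative real
part. -/
theorem exists_finset_addChar_of_density {G : Type*} [AddCommGroup G] [Fintype G]
    (A : Finset G) {α : ℝ} (hα : 0 < α) (hA : α * Fintype.card G ≤ A.card) :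
    ∃ Λ : Finset (AddChar G ℂ), (Λ.card : ℝ) ≤ 2 / α ^ 2 ∧
      ∀ x, (∀ ψ ∈ Λ, 0 ≤ (ψ x).re) →
        ∃ a ∈ A, ∃ b ∈ A, ∃ c ∈ A, ∃ d ∈ A, x = a + b - c - d := by
  classical
  set S : AddChar G ℂ → ℂ := fun ψ => ∑ a ∈ A, ψ a with hS
  set T : AddChar G ℂ → ℝ := fun ψ => ‖S ψ‖ ^ 2 with hT
  have hG : 0 < (Fintype.card G : ℝ) := by exact_mod_cast Fintype.card_pos
  have hA0 : 0 < (A.card : ℝ) := lt_of_lt_of_le (by positivity) hA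
  have hAG : (A.card : ℝ) ≤ Fintype.card G := by exact_mod_cast A.card_le_univ
  have hα1 : α ≤ 1 := by
    by_contra h
    push Not at h
    nlinarith
  have hTC : ∀ ψ, (T ψ : ℂ) = ∑ a ∈ A, ∑ b ∈ A, ψ (a - b) := by
    intro ψ
    have : (T ψ : ℂ) = S ψ * (starRingEnd ℂ) (S ψ) := by
      rw [Complex.mul_conj, Complex.normSq_eq_norm_sq]
    rw [this, hS]
    simp only [map_sum, Finset.sum_mul_sum, ← AddChar.map_neg_eq_conj, ← AddChar.map_add_eq_mul,
      sub_eq_add_neg]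
  have hsumT : ∑ ψ, T ψ = A.card * Fintype.card G := by
    have : ((∑ ψ, T ψ : ℝ) : ℂ) = ((A.card * Fintype.card G : ℝ) : ℂ) := by
      push_cast
      simp only [hTC]
      rw [Finset.sum_comm]
      have : ∀ a ∈ A, ∑ ψ : AddChar G ℂ, ∑ b ∈ A, ψ (a - b) = Fintype.card G := by
        intro a ha
        rw [Finset.sum_comm]
        simp only [AddChar.sum_apply_eq_ite, sub_eq_zero]
        simp [ha]
      rw [Finset.sum_congr rfl this]
      simp
    exact_mod_cast this
  have hT0 : T 0 = (A.card : ℝ) ^ 2 := by simp [hT, hS]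
  have hTnn : ∀ ψ, 0 ≤ T ψ := fun ψ => by positivity
  -- the characters with a large Fourier coefficient; there are few of them by Parseval's identity
  refine ⟨Finset.univ.filter fun ψ => α / 2 * (A.card : ℝ) ^ 2 ≤ T ψ, ?_, ?_⟩
  · set Λ := Finset.univ.filter fun ψ => α / 2 * (A.card : ℝ) ^ 2 ≤ T ψ
    have h1 : (Λ.card : ℝ) * (α / 2 * (A.card : ℝ) ^ 2) ≤ A.card * Fintype.card G := by
      rw [← hsumT, ← nsmul_eq_mul]
      refine (Finset.card_nsmul_le_sum Λ T _ fun ψ hψ => (Finset.mem_filter.1 hψ).2).trans ?_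
      exact Finset.sum_le_univ_sum_of_nonneg hTnn
    rw [le_div_iff₀ (by positivity)]
    have h2 : (Λ.card : ℝ) * α * A.card ≤ 2 * Fintype.card G := by
      have : ((Λ.card : ℝ) * α * A.card) * A.card ≤ (2 * Fintype.card G) * A.card := by
        nlinarith
      exact le_of_mul_le_mul_right this hA0
    have h3 : (Λ.card : ℝ) * α * (α * Fintype.card G) ≤ 2 * Fintype.card G :=
      (mul_le_mul_of_nonneg_left hA (by positivity)).trans h2
    have : ((Λ.card : ℝ) * α ^ 2) * Fintype.card G ≤ 2 * Fintype.card G := by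
      calc _ = (Λ.card : ℝ) * α * (α * Fintype.card G) := by ring
        _ ≤ _ := h3
    exact le_of_mul_le_mul_right this hG
  · intro x hx
    by_contra hcon
    push Not at hcon
    -- by orthogonality, `∑ T(ψ)² ψ(-x)` counts the representations `x = a + b - c - d`
    have hzero : ∑ ψ, T ψ ^ 2 * (ψ x).re = 0 := by
      have h1 : ∑ ψ : AddChar G ℂ, (T ψ : ℂ) ^ 2 * ψ (-x) = 0 := by
        have : ∀ ψ : AddChar G ℂ, (T ψ : ℂ) ^ 2 * ψ (-x) =
            ∑ a ∈ A, ∑ c ∈ A, ∑ b ∈ A, ∑ d ∈ A, ψ (a - c + (b - d) + -x) := by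
          intro ψ
          rw [sq, hTC, Finset.sum_mul, Finset.sum_mul]
          refine Finset.sum_congr rfl fun a _ => ?_
          rw [Finset.sum_mul, Finset.sum_mul]
          refine Finset.sum_congr rfl fun c _ => ?_
          simp only [Finset.mul_sum, Finset.sum_mul, AddChar.map_add_eq_mul]
        simp only [this]
        rw [Finset.sum_comm]
        refine Finset.sum_eq_zero fun a ha => ?_
        rw [Finset.sum_comm]
        refine Finset.sum_eq_zero fun c hc => ?_
        rw [Finset.sum_comm]
        refine Finset.sum_eq_zero fun b hb => ?_
        rw [Finset.sum_comm]
        refine Finset.sum_eq_zero fun d hd => ?_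
        rw [AddChar.sum_apply_eq_ite, if_neg]
        intro h
        refine hcon a ha b hb c hc d hd ?_
        rw [← sub_eq_add_neg, sub_eq_zero] at h
        rw [← h]; abel
      have h2 := congrArg Complex.re h1
      rw [Complex.re_sum] at h2
      rw [← Complex.zero_re, ← h2]
      refine Finset.sum_congr rfl fun ψ _ => ?_
      rw [AddChar.map_neg_eq_conj, ← Complex.ofReal_pow, Complex.re_ofReal_mul, Complex.conj_re]
    -- the trivial character alone outweighs the negative contributions
    have hbound : ∀ ψ : AddChar G ℂ, (if ψ = 0 then (A.card : ℝ) ^ 4 else 0) -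
        α / 2 * (A.card : ℝ) ^ 2 * T ψ ≤ T ψ ^ 2 * (ψ x).re := by
      intro ψ
      by_cases h0 : ψ = 0
      · subst h0
        simp only [if_true, AddChar.zero_apply, Complex.one_re, hT0]
        have : 0 ≤ α / 2 * (A.card : ℝ) ^ 2 * (A.card : ℝ) ^ 2 := by positivity
        nlinarith
      · rw [if_neg h0]
        by_cases hψ : α / 2 * (A.card : ℝ) ^ 2 ≤ T ψ
        · have h1 := hx ψ (Finset.mem_filter.2 ⟨Finset.mem_univ _, hψ⟩)
          have h2 : 0 ≤ T ψ ^ 2 * (ψ x).re := by positivity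
          have : 0 ≤ α / 2 * (A.card : ℝ) ^ 2 * T ψ := mul_nonneg (by positivity) (hTnn ψ)
          linarith
        · push Not at hψ
          have h1 : -1 ≤ (ψ x).re := by
            have := Complex.abs_re_le_norm (ψ x)
            rw [AddChar.norm_apply] at this
            exact (abs_le.1 this).1
          have h2 := hTnn ψ
          nlinarith [mul_le_mul_of_nonneg_left h1 (sq_nonneg (T ψ)),
            mul_le_mul_of_nonneg_right hψ.le h2]
    have hsum := Finset.sum_le_sum fun (ψ : AddChar G ℂ) (_ : ψ ∈ Finset.univ) => hbound ψ
    rw [hzero, Finset.sum_sub_distrib, ← Finset.mul_sum, hsumT, Finset.sum_ite_eq' ] at hsum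
    simp only [Finset.mem_univ, if_true] at hsum
    have h1 : α / 2 * (A.card : ℝ) ^ 2 * (A.card * Fintype.card G) ≤ (A.card : ℝ) ^ 4 / 2 := by
      calc _ = (A.card : ℝ) ^ 3 / 2 * (α * Fintype.card G) := by ring
        _ ≤ (A.card : ℝ) ^ 3 / 2 * A.card := mul_le_mul_of_nonneg_left hA (by positivity)
        _ = _ := by ring
    have : 0 < (A.card : ℝ) ^ 4 := by positivity
    linarith

/-- Characters converge pointwise along every ultrafilter: the dual of a discrete group is
compact. -/
theorem exists_addChar_tendsto {ι V : Type*} [AddCommGroup V] (U : Ultrafilter ι)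
    (θ : ι → AddChar V Circle) :
    ∃ χ : AddChar V Circle, ∀ x, Tendsto (fun i => θ i x) U (𝓝 (χ x)) := by
  have h : ∀ x, ∃ c : Circle, Tendsto (fun i => θ i x) U (𝓝 c) := fun x =>
    ⟨(U.map fun i => θ i x).lim, (U.map fun i => θ i x).le_nhds_lim⟩
  choose c hc using h
  refine ⟨⟨c, ?_, fun a b => ?_⟩, hc⟩
  · refine tendsto_nhds_unique (hc 0) ?_
    simp
  · refine tendsto_nhds_unique (hc (a + b)) ?_
    simp only [AddChar.map_add_eq_mul]
    exact (hc a).mul (hc b)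

/-- Finitary form of Bogolyubov's lemma in `ℤⁿ`: the group is wrapped around the torus
`(ℤ/4RN)ⁿ`, only points of `A` in the cube `[0, RN)ⁿ` being used, so that no sum of four of them
wraps around. The number of characters does not depend on `N`. -/
theorem exists_addChar_of_syndetic_of_bound {n : ℕ} {A : Set (Fin n → ℤ)} {R : ℕ} (hR : 0 < R)
    (hA : ∀ ξ : Fin n → ℤ, ∃ a ∈ A, ∀ k, ξ k ≤ a k ∧ a k < ξ k + R) (N : ℕ) (hN : 0 < N) :
    ∃ θ : Fin ⌊2 / ((((4 * R : ℕ) : ℝ) ^ n)⁻¹) ^ 2⌋₊ → AddChar (Fin n → ℤ) Circle,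
      ∀ x : Fin n → ℤ, (∀ k, |x k| < 2 * (R * N)) → (∀ i, 0 ≤ (θ i x : ℂ).re) →
        ∃ a ∈ A, ∃ b ∈ A, ∃ c ∈ A, ∃ d ∈ A, x = a + b - c - d := by
  classical
  set α : ℝ := (((4 * R : ℕ) : ℝ) ^ n)⁻¹ with hα
  set K := ⌊2 / α ^ 2⌋₊ with hK
  have : NeZero (4 * R * N) := ⟨by positivity⟩
  let π : (Fin n → ℤ) →+ (Fin n → ZMod (4 * R * N)) :=
    { toFun := fun x k => (x k : ZMod (4 * R * N))
      map_zero' := by funext k; simp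
      map_add' := fun x y => by funext k; simp }
  have hπ : ∀ x y : Fin n → ℤ, (∀ k, |x k - y k| < 4 * R * N) → π x = π y → x = y := by
    intro x y hxy h
    funext k
    have h1 : ((x k : ℤ) : ZMod (4 * R * N)) = (y k : ℤ) := congrFun h k
    rw [ZMod.intCast_eq_intCast_iff_dvd_sub] at h1
    have h2 := Int.eq_zero_of_abs_lt_dvd h1 (by
      rw [abs_sub_comm]; push_cast; exact hxy k)
    omega
  choose a haA ha using hA
  let g : (Fin n → Fin N) → (Fin n → ℤ) := fun q => a fun k => (R : ℤ) * (q k : ℕ)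
  have hg : ∀ q k, 0 ≤ g q k ∧ g q k < R * N := by
    intro q k
    obtain ⟨h1, h2⟩ := ha (fun k => (R : ℤ) * (q k : ℕ)) k
    have h3 : ((q k : ℕ) : ℤ) + 1 ≤ N := by exact_mod_cast (q k).2
    have h4 : (0 : ℤ) ≤ (q k : ℕ) := by positivity
    have h5 : (0 : ℤ) ≤ R := by positivity
    constructor
    · exact (mul_nonneg h5 h4).trans h1
    · refine h2.trans_le ?_
      calc (R : ℤ) * (q k : ℕ) + R = R * ((q k : ℕ) + 1) := by ring
        _ ≤ R * N := mul_le_mul_of_nonneg_left h3 h5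
  have hginj : Function.Injective fun q => π (g q) := by
    intro q q' h
    have h1 : g q = g q' := by
      refine hπ _ _ (fun k => ?_) h
      have h1 := hg q k
      have h2 := hg q' k
      have h3 : (0 : ℤ) ≤ R * N := by positivity
      rw [abs_lt]
      constructor <;> nlinarith
    funext k
    have h2 := ha (fun k => (R : ℤ) * (q k : ℕ)) k
    have h3 := ha (fun k => (R : ℤ) * (q' k : ℕ)) k
    change (R : ℤ) * (q k : ℕ) ≤ g q k ∧ g q k < (R : ℤ) * (q k : ℕ) + R at h2
    change (R : ℤ) * (q' k : ℕ) ≤ g q' k ∧ g q' k < (R : ℤ) * (q' k : ℕ) + R at h3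
    rw [← h1] at h3
    have hR' : (0 : ℤ) < R := by exact_mod_cast hR
    have h4 : ((q k : ℕ) : ℤ) < (q' k : ℕ) + 1 := by
      have : (R : ℤ) * (q k : ℕ) < R * ((q' k : ℕ) + 1) := by linarith
      exact lt_of_mul_lt_mul_left this hR'.le
    have h5 : ((q' k : ℕ) : ℤ) < (q k : ℕ) + 1 := by
      have : (R : ℤ) * (q' k : ℕ) < R * ((q k : ℕ) + 1) := by linarith
      exact lt_of_mul_lt_mul_left this hR'.le
    apply Fin.ext
    omega
  -- one point of `A` for each of the `Nⁿ` subcubes of side `R`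
  set B : Finset (Fin n → ZMod (4 * R * N)) := Finset.univ.image fun q => π (g q) with hB
  have hBcard : B.card = N ^ n := by
    rw [hB, Finset.card_image_of_injective _ hginj]
    simp
  have hdens : α * Fintype.card (Fin n → ZMod (4 * R * N)) ≤ B.card := by
    rw [hBcard]
    simp only [Fintype.card_fun, ZMod.card, Fintype.card_fin]
    push_cast
    rw [hα]
    push_cast
    rw [mul_pow (4 * (R : ℝ)), inv_mul_cancel_left₀ (by positivity)]
  obtain ⟨Λ, hΛ, hx⟩ := exists_finset_addChar_of_density B (by positivity) hdens
  have hΛK : Λ.card ≤ K := Nat.le_floor hΛ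
  let ψ : Fin K → AddChar (Fin n → ZMod (4 * R * N)) ℂ := fun i =>
    if h : i.1 < Λ.card then (Λ.equivFin.symm ⟨i.1, h⟩ : AddChar _ ℂ) else 0
  have hψ : ∀ φ ∈ Λ, ∃ i, ψ i = φ := by
    intro φ hφ
    refine ⟨Fin.castLE hΛK (Λ.equivFin ⟨φ, hφ⟩), ?_⟩
    have : (Λ.equivFin ⟨φ, hφ⟩ : ℕ) < Λ.card := (Λ.equivFin ⟨φ, hφ⟩).2
    simp [ψ]
  refine ⟨fun i => (AddChar.circleEquivComplex.symm (ψ i)).compAddMonoidHom π, ?_⟩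
  intro x hxb hre
  have hre' : ∀ φ ∈ Λ, 0 ≤ (φ (π x)).re := by
    intro φ hφ
    obtain ⟨i, rfl⟩ := hψ φ hφ
    exact hre i
  obtain ⟨p, hp, q, hq, r, hr, s, hs, h⟩ := hx (π x) hre'
  simp only [hB, Finset.mem_image, Finset.mem_univ, true_and] at hp hq hr hs
  obtain ⟨p, rfl⟩ := hp
  obtain ⟨q, rfl⟩ := hq
  obtain ⟨r, rfl⟩ := hr
  obtain ⟨s, rfl⟩ := hs
  refine ⟨g p, haA _, g q, haA _, g r, haA _, g s, haA _, hπ _ _ (fun k => ?_) ?_⟩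
  · have h1 := hg p k
    have h2 := hg q k
    have h3 := hg r k
    have h4 := hg s k
    have h5 := abs_lt.1 (hxb k)
    simp only [Pi.add_apply, Pi.sub_apply]
    rw [abs_lt]
    constructor <;> nlinarith
  · rw [h]; simp only [map_add, map_sub]

/-- Bogolyubov's lemma in `ℤⁿ`, for a set that meets all cubes of side `R`. -/
theorem exists_addChar_of_syndetic {n : ℕ} {A : Set (Fin n → ℤ)} {R : ℕ} (hR : 0 < R)
    (hA : ∀ ξ : Fin n → ℤ, ∃ a ∈ A, ∀ k, ξ k ≤ a k ∧ a k < ξ k + R) :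
    ∃ (K : ℕ) (θ : Fin K → AddChar (Fin n → ℤ) Circle),
      ∀ x : Fin n → ℤ, (∀ i, 0 < (θ i x : ℂ).re) →
        ∃ a ∈ A, ∃ b ∈ A, ∃ c ∈ A, ∃ d ∈ A, x = a + b - c - d := by
  choose θ hθ using fun N : ℕ =>
    exists_addChar_of_syndetic_of_bound hR hA (N + 1) N.succ_pos
  choose χ hχ using fun i => exists_addChar_tendsto (hyperfilter ℕ) fun N => θ N i
  refine ⟨_, χ, fun x hx => ?_⟩
  have h1 : ∀ᶠ N in (hyperfilter ℕ : Filter ℕ), ∀ i, 0 < (θ N i x : ℂ).re := by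
    rw [eventually_all]
    intro i
    have : Tendsto (fun N => (θ N i x : ℂ).re) (hyperfilter ℕ) (𝓝 (χ i x : ℂ).re) :=
      (Complex.continuous_re.comp continuous_subtype_val).continuousAt.tendsto.comp (hχ i x)
    exact this.eventually (lt_mem_nhds (hx i))
  have h2 : ∀ᶠ N in (hyperfilter ℕ : Filter ℕ), ∀ k, |x k| < 2 * (R * ((N + 1 : ℕ) : ℤ)) := by
    refine Nat.hyperfilter_le_atTop ?_
    refine eventually_all.2 fun k => ?_
    filter_upwards [eventually_ge_atTop (x k).natAbs] with N hN
    have h3 : |x k| ≤ N := by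
      rw [Int.abs_eq_natAbs]; exact_mod_cast hN
    have hR' : (1 : ℤ) ≤ R := by exact_mod_cast hR
    push_cast
    nlinarith
  obtain ⟨N, hN1, hN2⟩ := (h1.and h2).exists
  exact hθ N x hN2 fun i => (hN1 i).le

/-- The continuous character `μ ↦ exp(i⟨t, μ⟩)` of `ℝⁿ`. -/
def phase {n : ℕ} (t : Fin n → ℝ) : AddChar (Fin n → ℝ) Circle where
  toFun μ := Circle.exp (t ⬝ᵥ μ)
  map_zero_eq_one' := by simp
  map_add_eq_mul' a b := by rw [dotProduct_add, Circle.exp_add]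

theorem phase_apply {n : ℕ} (t μ : Fin n → ℝ) : phase t μ = Circle.exp (t ⬝ᵥ μ) := rfl

theorem coe_phase {n : ℕ} (t μ : Fin n → ℝ) :
    (phase t μ : ℂ) = Complex.exp (((t ⬝ᵥ μ : ℝ) : ℂ) * Complex.I) := by
  rw [phase_apply, Circle.coe_exp]

theorem phase_add {n : ℕ} (s t μ : Fin n → ℝ) :
    phase (s + t) μ = phase s μ * phase t μ := by
  simp only [phase_apply, add_dotProduct, Circle.exp_add]

theorem norm_phase_sub_phase_le {n : ℕ} {η : ℝ} (s t μ : Fin n → ℝ)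
    (h : ∀ k, |s k - t k| ≤ η) :
    ‖(phase s μ : ℂ) - phase t μ‖ ≤ η * ∑ k, |μ k| := by
  have h1 : (phase s μ : ℂ) - phase t μ = phase t μ * ((phase (s - t) μ : ℂ) - 1) := by
    have : phase s μ = phase t μ * phase (s - t) μ := by
      rw [← phase_add]; congr 1; abel_nf
    rw [this]; push_cast; ring
  rw [h1, norm_mul, Circle.norm_coe, one_mul, coe_phase, mul_comm]
  refine (Real.norm_exp_I_mul_ofReal_sub_one_le).trans ?_
  rw [Real.norm_eq_abs, dotProduct, Finset.mul_sum]
  refine (Finset.abs_sum_le_sum_abs _ _).trans (Finset.sum_le_sum fun k _ => ?_)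
  rw [abs_mul]
  exact mul_le_mul_of_nonneg_right (h k) (abs_nonneg _)

/-- A real number whose phase is close to `1` is close to an integer multiple of `2π`. -/
theorem exists_delta_near_int {η : ℝ} (hη : 0 < η) :
    ∃ δ > 0, ∀ x : ℝ, ‖Complex.exp ((x : ℂ) * Complex.I) - 1‖ < δ →
      ∃ m : ℤ, |x - 2 * Real.pi * m| ≤ η := by
  have h : ContinuousAt Complex.arg 1 := Complex.continuousAt_arg (by simp [Complex.slitPlane])
  obtain ⟨δ, hδ, hd⟩ := Metric.continuousAt_iff.1 h η hη
  refine ⟨δ, hδ, fun x hx => ?_⟩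
  have h1 := hd (x := Complex.exp ((x : ℂ) * Complex.I)) (by rwa [dist_eq_norm])
  rw [Complex.arg_one, Real.dist_eq, sub_zero] at h1
  have h2 := Complex.norm_mul_exp_arg_mul_I (Complex.exp ((x : ℂ) * Complex.I))
  rw [Complex.norm_exp_ofReal_mul_I, Complex.ofReal_one, one_mul, eq_comm,
    Complex.exp_eq_exp_iff_exists_int] at h2
  obtain ⟨m, hm⟩ := h2
  refine ⟨m, ?_⟩
  have h3 : x = (Complex.exp ((x : ℂ) * Complex.I)).arg + m * (2 * Real.pi) := by
    have h4 : ((x : ℝ) : ℂ) * Complex.I =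
        (((Complex.exp ((x : ℂ) * Complex.I)).arg + m * (2 * Real.pi) : ℝ) : ℂ) * Complex.I := by
      push_cast; linear_combination hm
    exact_mod_cast mul_right_cancel₀ Complex.I_ne_zero h4
  have h5 : x - 2 * Real.pi * m = (Complex.exp ((x : ℂ) * Complex.I)).arg := by linarith
  rw [h5]; exact h1.le

/-- Every character of `ℤⁿ` is the restriction of a continuous character of `ℝⁿ`. -/
theorem exists_phase_eq {n : ℕ} (θ : AddChar (Fin n → ℤ) Circle) :
    ∃ φ : Fin n → ℝ, ∀ x : Fin n → ℤ, θ x = phase (fun k => (x k : ℝ)) φ := by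
  refine ⟨fun k => Complex.arg (θ (Pi.single k 1)), fun x => ?_⟩
  have hx : x = ∑ k, x k • (Pi.single k 1 : Fin n → ℤ) := by
    funext j
    simp [Finset.sum_apply, Pi.single_apply]
  have h1 : θ x = ∏ k, θ (Pi.single k 1) ^ x k := by
    conv_lhs => rw [hx]
    have h2 := map_prod θ.toMonoidHom
      (fun k => Multiplicative.ofAdd (x k • (Pi.single k 1 : Fin n → ℤ))) Finset.univ
    rw [← ofAdd_sum] at h2
    refine h2.trans (Finset.prod_congr rfl fun k _ => ?_)
    exact AddChar.map_zsmul_eq_zpow _ _ _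
  rw [h1, phase_apply, dotProduct]
  have h3 : ∀ s : Finset (Fin n), ∀ r : Fin n → ℝ,
      Circle.exp (∑ k ∈ s, r k) = ∏ k ∈ s, Circle.exp (r k) := by
    intro s r
    induction s using Finset.cons_induction with
    | empty => simp
    | cons a s ha ih => rw [Finset.sum_cons, Finset.prod_cons, Circle.exp_add, ih]
  rw [h3]
  refine Finset.prod_congr rfl fun k _ => ?_
  rw [Circle.exp_intCast_mul, Circle.exp_arg]

/-- **Bogolyubov's theorem** in `ℝⁿ`: if `P` is relatively dense, then a Bohr neighbourhood of
zero is contained in an arbitrarily small neighbourhood of `P + P - P - P`. -/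
theorem exists_bohr_set_of_relatively_dense {n : ℕ} {P : Set (Fin n → ℝ)} {R : ℝ}
    (hP : ∀ ξ : Fin n → ℝ, ∃ τ ∈ P, ∀ k, |τ k - ξ k| < R) {u : ℝ} (hu : 0 < u) :
    ∃ (Λ : Finset (Fin n → ℝ)) (δ : ℝ), 0 < δ ∧
      ∀ τ : Fin n → ℝ, (∀ μ ∈ Λ, ‖(phase τ μ : ℂ) - 1‖ < δ) →
        ∃ a ∈ P, ∃ b ∈ P, ∃ c ∈ P, ∃ d ∈ P, ∀ k, |τ k - (a + b - c - d) k| ≤ u := by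
  classical
  set h : ℝ := u / 5 with hh
  have hpos : 0 < h := by positivity
  -- `P` rounded to the lattice `hℤⁿ`
  set A : Set (Fin n → ℤ) := {x | ∃ p ∈ P, ∀ k, |p k - h * x k| ≤ h} with hA
  obtain ⟨Q, hQ⟩ := exists_nat_gt (R / h)
  have hQR : R < h * Q := by rwa [div_lt_iff₀' hpos] at hQ
  have hsynd : ∀ ξ : Fin n → ℤ, ∃ a ∈ A, ∀ k, ξ k ≤ a k ∧ a k < ξ k + (2 * Q + 1 : ℕ) := by
    intro ξ
    obtain ⟨τ, hτ, hd⟩ := hP fun k => h * (ξ k + Q)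
    refine ⟨fun k => ⌊τ k / h⌋, ⟨τ, hτ, fun k => ?_⟩, fun k => ?_⟩
    · have h1 := Int.floor_le (τ k / h)
      have h2 := Int.lt_floor_add_one (τ k / h)
      rw [le_div_iff₀' hpos] at h1
      rw [div_lt_iff₀' hpos] at h2
      rw [abs_le]
      constructor <;> linarith
    · have h1 := abs_lt.1 (hd k)
      constructor
      · rw [Int.le_floor, le_div_iff₀' hpos]
        linarith
      · rw [Int.floor_lt, div_lt_iff₀' hpos]
        push_cast
        nlinarith
  obtain ⟨K, θ, hθ⟩ := exists_addChar_of_syndetic (Nat.succ_pos _) hsynd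
  choose φ hφ using fun i => exists_phase_eq (θ i)
  -- `η` is so small that a perturbation of the lattice point by `η` moves no `θ i` by `1/2`
  obtain ⟨η, hη, hη1, hηφ⟩ : ∃ η > 0, η ≤ 1 ∧ ∀ i, η * ∑ k, |φ i k| ≤ 1 / 2 := by
    have hs : 0 ≤ ∑ i, ∑ k, |φ i k| :=
      Finset.sum_nonneg fun i _ => Finset.sum_nonneg fun k _ => abs_nonneg _
    refine ⟨1 / (2 * (1 + ∑ i, ∑ k, |φ i k|)), by positivity, ?_, fun i => ?_⟩
    · rw [div_le_one (by positivity)]; linarith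
    · have h1 : ∑ k, |φ i k| ≤ ∑ i, ∑ k, |φ i k| :=
        Finset.single_le_sum (f := fun i => ∑ k, |φ i k|)
          (fun i _ => Finset.sum_nonneg fun k _ => abs_nonneg _) (Finset.mem_univ i)
      rw [div_mul_eq_mul_div, one_mul, div_le_div_iff₀ (by positivity) (by positivity)]
      linarith
  obtain ⟨δ, hδ, hδm⟩ := exists_delta_near_int (η := 2 * Real.pi * η) (by positivity)
  -- the frequencies `2π/h` force `τ` to be close to the lattice `hℤⁿ`
  refine ⟨Finset.univ.image (fun i => h⁻¹ • φ i) ∪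
    Finset.univ.image (fun k => (2 * Real.pi / h) • (Pi.single k 1 : Fin n → ℝ)),
    min δ (1 / 2), by positivity, fun τ hτ => ?_⟩
  have hm : ∀ k, ∃ m : ℤ, |τ k / h - m| ≤ η := by
    intro k
    have h1 := hτ ((2 * Real.pi / h) • (Pi.single k 1 : Fin n → ℝ)) (by simp)
    rw [coe_phase, dotProduct_smul, dotProduct_single, mul_one] at h1
    obtain ⟨m, hm⟩ := hδm _ (h1.trans_le (min_le_left _ _))
    refine ⟨m, ?_⟩
    have h2 : (2 * Real.pi / h) • τ k - 2 * Real.pi * m = 2 * Real.pi * (τ k / h - m) := by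
      rw [smul_eq_mul]; ring
    rw [h2, abs_mul, abs_of_pos (by positivity)] at hm
    exact le_of_mul_le_mul_left hm (by positivity)
  choose x hx using hm
  have hre : ∀ i, 0 < (θ i x : ℂ).re := by
    intro i
    have h1 := hτ (h⁻¹ • φ i) (by simp)
    have h2 : phase τ (h⁻¹ • φ i) = phase (h⁻¹ • τ) (φ i) := by
      simp [phase_apply]
    have h3 : ‖(phase (h⁻¹ • τ) (φ i) : ℂ) - phase (fun k => (x k : ℝ)) (φ i)‖ ≤ 1 / 2 := by
      refine (norm_phase_sub_phase_le _ _ _ fun k => ?_).trans (hηφ i)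
      have := hx k
      rwa [div_eq_inv_mul] at this
    rw [h2] at h1
    rw [hφ]
    have h4 : ‖(phase (fun k => (x k : ℝ)) (φ i) : ℂ) - 1‖ < 1 := by
      have h5 := h1.trans_le (min_le_right _ _)
      have h6 := norm_sub_le ((phase (h⁻¹ • τ) (φ i) : ℂ) - 1)
        ((phase (h⁻¹ • τ) (φ i) : ℂ) - phase (fun k => (x k : ℝ)) (φ i))
      rw [sub_sub_sub_cancel_left] at h6
      linarith
    have h5 := (Complex.abs_re_le_norm _).trans_lt h4
    rw [Complex.sub_re, Complex.one_re, abs_lt] at h5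
    linarith
  obtain ⟨a, ⟨pa, hpa, ha⟩, b, ⟨pb, hpb, hb⟩, c, ⟨pc, hpc, hc⟩, d, ⟨pd, hpd, hd⟩, he⟩ := hθ x hre
  refine ⟨pa, hpa, pb, hpb, pc, hpc, pd, hpd, fun k => ?_⟩
  have e1 := abs_le.1 (ha k)
  have e2 := abs_le.1 (hb k)
  have e3 := abs_le.1 (hc k)
  have e4 := abs_le.1 (hd k)
  have e5 : |τ k - h * x k| ≤ h := by
    have : τ k - h * x k = h * (τ k / h - x k) := by field_simp
    rw [this, abs_mul, abs_of_pos hpos]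
    nlinarith [hx k]
  have e6 := abs_le.1 e5
  have e7 : (x k : ℝ) = a k + b k - c k - d k := by rw [he]; simp
  rw [e7] at e6
  simp only [Pi.add_apply, Pi.sub_apply]
  rw [abs_le]
  constructor <;> nlinarith

/-! ### Means over large cubes -/

/-- The average of `φ` over the cube `{x : |x₁|, …, |xₙ| < s}`. -/
def boxAvg {n : ℕ} (φ : (Fin n → ℝ) → ℂ) (s : ℝ) : ℂ :=
  ((((2 * s) ^ n)⁻¹ : ℝ) : ℂ) * ∫ x in {x : Fin n → ℝ | ∀ k, |x k| < s}, φ x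

/-- `a` is the limit, along the filter `l`, of the averages of `φ` over the cubes of half side `s`.
For `l = atTop` this is the mean value of `φ`; for an ultrafilter `l` finer than `atTop` it is an
invariant mean, defined for all bounded continuous functions. -/
def HasMean {n : ℕ} (l : Filter ℝ) (φ : (Fin n → ℝ) → ℂ) (a : ℂ) : Prop :=
  Tendsto (boxAvg φ) l (𝓝 a)

theorem box_eq_pi (n : ℕ) (s : ℝ) :
    {x : Fin n → ℝ | ∀ k, |x k| < s} = Set.pi Set.univ fun _ => Set.Ioo (-s) s := by
  ext x
  simp [Set.mem_pi, abs_lt]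

theorem measurableSet_box (n : ℕ) (s : ℝ) : MeasurableSet {x : Fin n → ℝ | ∀ k, |x k| < s} := by
  rw [box_eq_pi]
  exact MeasurableSet.univ_pi fun _ => measurableSet_Ioo

theorem volume_box (n : ℕ) (s : ℝ) :
    volume {x : Fin n → ℝ | ∀ k, |x k| < s} = ENNReal.ofReal (2 * s) ^ n := by
  rw [box_eq_pi, Real.volume_pi_Ioo]
  simp only [Finset.prod_const, Finset.card_univ, Fintype.card_fin]
  congr 2
  ring

theorem volume_real_box {n : ℕ} {s : ℝ} (hs : 0 ≤ s) :
    volume.real {x : Fin n → ℝ | ∀ k, |x k| < s} = (2 * s) ^ n := by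
  rw [Measure.real, volume_box, ENNReal.toReal_pow, ENNReal.toReal_ofReal (by linarith)]

theorem volume_box_ne_top (n : ℕ) (s : ℝ) :
    volume {x : Fin n → ℝ | ∀ k, |x k| < s} ≠ ⊤ := by
  rw [volume_box]
  exact ENNReal.pow_ne_top ENNReal.ofReal_ne_top

theorem integrableOn_box {n : ℕ} {E : Type*} [NormedAddCommGroup E] {φ : (Fin n → ℝ) → E}
    (hφ : Continuous φ) (s : ℝ) :
    IntegrableOn φ {x : Fin n → ℝ | ∀ k, |x k| < s} := by
  refine (hφ.continuousOn.integrableOn_compact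
    (isCompact_Icc (a := fun _ => -s) (b := fun _ => s))).mono_set ?_
  intro x hx
  exact ⟨fun k => (abs_lt.1 (hx k)).1.le, fun k => (abs_lt.1 (hx k)).2.le⟩

theorem boxAvg_add {n : ℕ} {φ ψ : (Fin n → ℝ) → ℂ} (hφ : Continuous φ) (hψ : Continuous ψ)
    (s : ℝ) : boxAvg (fun t => φ t + ψ t) s = boxAvg φ s + boxAvg ψ s := by
  rw [boxAvg, integral_add (integrableOn_box hφ s) (integrableOn_box hψ s), mul_add]
  rfl

theorem boxAvg_sub {n : ℕ} {φ ψ : (Fin n → ℝ) → ℂ} (hφ : Continuous φ) (hψ : Continuous ψ)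
    (s : ℝ) : boxAvg (fun t => φ t - ψ t) s = boxAvg φ s - boxAvg ψ s := by
  rw [boxAvg, integral_sub (integrableOn_box hφ s) (integrableOn_box hψ s), mul_sub]
  rfl

theorem boxAvg_const_mul {n : ℕ} (c : ℂ) (φ : (Fin n → ℝ) → ℂ) (s : ℝ) :
    boxAvg (fun t => c * φ t) s = c * boxAvg φ s := by
  rw [boxAvg, integral_const_mul, boxAvg]
  ring

theorem norm_boxAvg_le_boxAvg {n : ℕ} {φ : (Fin n → ℝ) → ℂ} {k : (Fin n → ℝ) → ℝ}
    (hk : Continuous k) (h : ∀ t, ‖φ t‖ ≤ k t) (s : ℝ) :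
    ‖boxAvg φ s‖ ≤ ‖boxAvg (fun t => (k t : ℂ)) s‖ := by
  rw [boxAvg, boxAvg, norm_mul, norm_mul]
  refine mul_le_mul_of_nonneg_left ?_ (norm_nonneg _)
  rw [integral_complex_ofReal, Complex.norm_real, Real.norm_eq_abs]
  refine le_trans ?_ (le_abs_self _)
  exact norm_integral_le_of_norm_le (integrableOn_box hk s) (Eventually.of_forall h)

theorem boxAvg_const {n : ℕ} (c : ℂ) {s : ℝ} (hs : 0 < s) :
    boxAvg (fun _ : Fin n → ℝ => c) s = c := by
  rw [boxAvg, setIntegral_const, volume_real_box hs.le, Complex.real_smul, ← mul_assoc,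
    ← Complex.ofReal_mul, inv_mul_cancel₀ (by positivity), Complex.ofReal_one, one_mul]

theorem norm_boxAvg_le {n : ℕ} {φ : (Fin n → ℝ) → ℂ} {B : ℝ} (h : ∀ t, ‖φ t‖ ≤ B) {s : ℝ}
    (hs : 0 < s) : ‖boxAvg φ s‖ ≤ B := by
  have hB : 0 ≤ B := (norm_nonneg _).trans (h 0)
  have := norm_boxAvg_le_boxAvg (k := fun _ => B) continuous_const h s
  rwa [boxAvg_const _ hs, Complex.norm_real, Real.norm_eq_abs, abs_of_nonneg hB] at this

namespace HasMean

variable {n : ℕ} {l : Filter ℝ} {φ ψ : (Fin n → ℝ) → ℂ} {a b : ℂ}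

theorem mono {l' : Filter ℝ} (h : HasMean l φ a) (hl : l' ≤ l) : HasMean l' φ a :=
  Tendsto.mono_left h hl

theorem unique [NeBot l] (h : HasMean l φ a) (h' : HasMean l φ b) : a = b :=
  tendsto_nhds_unique h h'

theorem add (hφ : Continuous φ) (hψ : Continuous ψ) (h : HasMean l φ a) (h' : HasMean l ψ b) :
    HasMean l (fun t => φ t + ψ t) (a + b) := by
  refine (Tendsto.add h h').congr fun s => ?_
  rw [boxAvg_add hφ hψ]

theorem sub (hφ : Continuous φ) (hψ : Continuous ψ) (h : HasMean l φ a) (h' : HasMean l ψ b) :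
    HasMean l (fun t => φ t - ψ t) (a - b) := by
  refine (Tendsto.sub h h').congr fun s => ?_
  rw [boxAvg_sub hφ hψ]

theorem const_mul (c : ℂ) (h : HasMean l φ a) : HasMean l (fun t => c * φ t) (c * a) := by
  refine (Tendsto.const_mul c h).congr fun s => ?_
  rw [boxAvg_const_mul]

theorem const (hl : l ≤ atTop) (c : ℂ) : HasMean l (fun _ : Fin n → ℝ => c) c := by
  refine Tendsto.mono_left ?_ hl
  refine tendsto_const_nhds.congr' ?_
  filter_upwards [eventually_gt_atTop 0] with s hs
  rw [boxAvg_const _ hs]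

theorem sum {ι : Type*} (S : Finset ι) {φ : ι → (Fin n → ℝ) → ℂ} {a : ι → ℂ}
    (hφ : ∀ i ∈ S, Continuous (φ i)) (h : ∀ i ∈ S, HasMean l (φ i) (a i)) :
    HasMean l (fun t => ∑ i ∈ S, φ i t) (∑ i ∈ S, a i) := by
  refine (tendsto_finsetSum S h).congr fun s => ?_
  rw [boxAvg, integral_finsetSum S fun i hi => integrableOn_box (hφ i hi) s, Finset.mul_sum]
  rfl

theorem norm_le [NeBot l] {k : (Fin n → ℝ) → ℝ} (hk : Continuous k) (hφk : ∀ t, ‖φ t‖ ≤ k t)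
    (h : HasMean l φ a) (h' : HasMean l (fun t => (k t : ℂ)) b) : ‖a‖ ≤ ‖b‖ :=
  le_of_tendsto_of_tendsto (Tendsto.norm h) (Tendsto.norm h')
    (Eventually.of_forall (norm_boxAvg_le_boxAvg hk hφk))

theorem norm_le_const [NeBot l] (hl : l ≤ atTop) {B : ℝ} (hB : ∀ t, ‖φ t‖ ≤ B)
    (h : HasMean l φ a) : ‖a‖ ≤ B := by
  refine le_of_tendsto (Tendsto.norm h) (hl ?_)
  filter_upwards [eventually_gt_atTop 0] with s hs
  exact norm_boxAvg_le hB hs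

/-- Averages of bounded functions converge along every ultrafilter. -/
theorem exists_of_bounded {U : Ultrafilter ℝ} (hU : (U : Filter ℝ) ≤ atTop) {B : ℝ}
    (hB : ∀ t, ‖φ t‖ ≤ B) : ∃ a, HasMean U φ a := by
  have h : ∀ᶠ s in (U : Filter ℝ), boxAvg φ s ∈ Metric.closedBall (0 : ℂ) B := by
    refine hU ?_
    filter_upwards [eventually_gt_atTop 0] with s hs
    rw [mem_closedBall_zero_iff]
    exact norm_boxAvg_le hB hs
  obtain ⟨a, -, ha⟩ := (isCompact_closedBall (0 : ℂ) B).ultrafilter_le_nhds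
    (U.map (boxAvg φ)) (le_principal_iff.2 h)
  exact ⟨a, ha⟩

end HasMean

theorem norm_boxAvg_translate_sub_le {n : ℕ} {φ : (Fin n → ℝ) → ℂ} (hφ : Continuous φ) {B : ℝ}
    (hB : ∀ t, ‖φ t‖ ≤ B) {τ : Fin n → ℝ} {T : ℝ} (hT : ∀ k, |τ k| ≤ T) (hT0 : 0 ≤ T) {s : ℝ}
    (hs : 0 < s) :
    ‖boxAvg (fun t => φ (t + τ)) s - boxAvg φ s‖ ≤ 2 * B * (((s + T) / s) ^ n - 1) := by
  set D : Set (Fin n → ℝ) := {x | ∀ k, |x k| < s + T} with hD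
  -- both cubes lie in `D`, and miss only a thin layer of it
  have key : ∀ S : Set (Fin n → ℝ), MeasurableSet S → S ⊆ D →
      volume.real S = (2 * s) ^ n → ‖(∫ x in D, φ x) - ∫ x in S, φ x‖ ≤
        B * ((2 * (s + T)) ^ n - (2 * s) ^ n) := by
    intro S hS hSD hvol
    rw [← setIntegral_sdiff hS (integrableOn_box hφ _) hSD]
    refine (norm_setIntegral_le_of_norm_le_const (C := B) ?_ fun x _ => hB x).trans_eq ?_
    · exact (measure_mono Set.sdiff_subset).trans_lt (volume_box_ne_top n (s + T)).lt_top
    · rw [measureReal_sdiff hSD hS (volume_box_ne_top n (s + T)), hvol, hD,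
        volume_real_box (by linarith)]
  set S : Set (Fin n → ℝ) := {x | ∀ k, |x k - τ k| < s} with hSdef
  have hpre : (fun x => x + τ) ⁻¹' S = {x : Fin n → ℝ | ∀ k, |x k| < s} := by
    ext x
    simp [hSdef]
  have hpre' : S = (fun x => x - τ) ⁻¹' {x : Fin n → ℝ | ∀ k, |x k| < s} := by
    ext x
    simp [hSdef]
  have hSm : MeasurableSet S := by
    rw [hpre']
    exact (measurable_id.sub_const τ) (measurableSet_box n s)
  have hmp := measurePreserving_add_right (volume : Measure (Fin n → ℝ)) τ
  have hint : ∫ x in {x : Fin n → ℝ | ∀ k, |x k| < s}, φ (x + τ) = ∫ x in S, φ x := by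
    rw [← hpre]
    exact hmp.setIntegral_preimage_emb (MeasurableEquiv.addRight τ).measurableEmbedding φ S
  have hSvol : volume.real S = (2 * s) ^ n := by
    rw [← volume_real_box hs.le, ← hpre, Measure.real, Measure.real,
      hmp.measure_preimage hSm.nullMeasurableSet]
  have h1 := key S hSm (fun x hx k => by
    have h1 := hx k
    have h2 := hT k
    calc |x k| = |(x k - τ k) + τ k| := by ring_nf
      _ ≤ |x k - τ k| + |τ k| := abs_add_le _ _
      _ < s + T := by linarith) hSvol
  have h2 := key {x | ∀ k, |x k| < s} (measurableSet_box n s) (fun x hx k => by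
    have := hx k
    linarith) (volume_real_box hs.le)
  have h3 : ‖(∫ x in S, φ x) - ∫ x in {x : Fin n → ℝ | ∀ k, |x k| < s}, φ x‖ ≤
      2 * B * ((2 * (s + T)) ^ n - (2 * s) ^ n) := by
    have h4 := norm_sub_le ((∫ x in D, φ x) - ∫ x in {x : Fin n → ℝ | ∀ k, |x k| < s}, φ x)
      ((∫ x in D, φ x) - ∫ x in S, φ x)
    rw [sub_sub_sub_cancel_left] at h4
    linarith
  rw [boxAvg, boxAvg, hint, ← mul_sub, norm_mul, Complex.norm_real, Real.norm_eq_abs, abs_of_pos (by positivity)]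
  refine (mul_le_mul_of_nonneg_left h3 (by positivity)).trans_eq ?_
  have h5 : (2 * s) ^ n ≠ 0 := by positivity
  have h6 : s ^ n ≠ 0 := by positivity
  have h7 : (2 * s)^n * ((s + T) / s) ^ n = (2 * (s + T)) ^ n := by
    rw [← mul_pow]
    congr 1
    field_simp
  rw [← h7]
  field_simp

/-- Means are invariant under translation. -/
theorem HasMean.translate {n : ℕ} {l : Filter ℝ} {φ : (Fin n → ℝ) → ℂ} {a : ℂ} (hl : l ≤ atTop)
    (hφ : Continuous φ) {B : ℝ} (hB : ∀ t, ‖φ t‖ ≤ B) (h : HasMean l φ a) (τ : Fin n → ℝ) :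
    HasMean l (fun t => φ (t + τ)) a := by
  have h0 : Tendsto (fun s => boxAvg (fun t => φ (t + τ)) s - boxAvg φ s) atTop (𝓝 0) := by
    have hT : ∀ k, |τ k| ≤ ∑ k, |τ k| := fun k =>
      Finset.single_le_sum (f := fun k => |τ k|) (fun _ _ => abs_nonneg _) (Finset.mem_univ k)
    have hT0 : 0 ≤ ∑ k, |τ k| := Finset.sum_nonneg fun _ _ => abs_nonneg _
    set T := ∑ k, |τ k|
    have h1 : Tendsto (fun s : ℝ => 2 * B * (((s + T) / s) ^ n - 1)) atTop (𝓝 0) := by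
      have h2 : Tendsto (fun s : ℝ => (s + T) / s) atTop (𝓝 1) := by
        have h3 : Tendsto (fun s : ℝ => 1 + T / s) atTop (𝓝 (1 + 0)) :=
          tendsto_const_nhds.add (tendsto_const_nhds.div_atTop tendsto_id)
        rw [add_zero] at h3
        refine h3.congr' ?_
        filter_upwards [eventually_gt_atTop 0] with s hs
        field_simp
      have h4 := ((h2.pow n).sub_const 1).const_mul (2 * B)
      simpa using h4
    refine squeeze_zero_norm' ?_ h1
    filter_upwards [eventually_gt_atTop 0] with s hs
    exact norm_boxAvg_translate_sub_le hφ hB hT hT0 hs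
  have := (h0.mono_left hl).add h
  rw [zero_add] at this
  refine this.congr fun s => ?_
  ring

theorem continuous_phase {n : ℕ} (μ : Fin n → ℝ) :
    Continuous fun t : Fin n → ℝ => (phase t μ : ℂ) := by
  simp only [coe_phase, dotProduct]
  fun_prop

/-- Nontrivial characters have mean zero. -/
theorem hasMean_phase {n : ℕ} [DecidableEq (Fin n → ℝ)] {l : Filter ℝ} (hl : l ≤ atTop)
    (μ : Fin n → ℝ) :
    HasMean l (fun t => (phase t μ : ℂ)) (if μ = 0 then 1 else 0) := by
  refine HasMean.mono ?_ hl
  by_cases hμ : μ = 0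
  · subst hμ
    simpa using HasMean.const le_rfl (1 : ℂ)
  rw [if_neg hμ]
  refine (tendsto_iff_ultrafilter _ _ _).2 fun U hU => ?_
  have hB : ∀ t : Fin n → ℝ, ‖(phase t μ : ℂ)‖ ≤ 1 := fun t => (Circle.norm_coe _).le
  obtain ⟨a, ha⟩ := HasMean.exists_of_bounded hU hB
  -- a translation by which the character is multiplied by `-1`
  obtain ⟨τ, hτ⟩ : ∃ τ : Fin n → ℝ, (phase τ μ : ℂ) = -1 := by
    refine ⟨(Real.pi / (μ ⬝ᵥ μ)) • μ, ?_⟩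
    have h0 : μ ⬝ᵥ μ ≠ 0 := by
      simpa [dotProduct_self_eq_zero] using hμ
    rw [coe_phase, smul_dotProduct, smul_eq_mul, div_mul_cancel₀ _ h0, Complex.exp_pi_mul_I]
  have h1 := ha.translate hU (continuous_phase μ) hB τ
  have h2 := ha.const_mul (-1)
  have h3 : a = -1 * a := by
    refine h1.unique ?_
    convert h2 using 2 with t
    rw [phase_add, Circle.coe_mul, hτ, mul_comm]
  have h4 : a = 0 := by
    have : (2 : ℂ) * a = 0 := by linear_combination h3
    simpa using this
  rw [h4] at ha
  exact ha

/-! ### Fejér kernels and Kronecker's theorem -/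

/-- A subspace of a rational vector space that is generated by countably many vectors has a basis
indexed by an initial segment of `ℕ`. -/
theorem exists_basis_of_countable {V : Type*} [AddCommGroup V] [Module ℚ V] {S : Set V}
    (hS : S.Countable) :
    ∃ I : Set ℕ, IsLowerSet I ∧ Nonempty (Module.Basis I ℚ (Submodule.span ℚ S)) := by
  obtain ⟨b, hbS, hspan, hli⟩ := exists_linearIndependent ℚ S
  have hb : b.Countable := hS.mono hbS
  have hcount : Countable b := hb
  obtain ⟨I, hI, ⟨e⟩⟩ : ∃ I : Set ℕ, IsLowerSet I ∧ Nonempty (b ≃ I) := by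
    cases finite_or_infinite b with
    | inl h =>
      obtain ⟨k, ⟨e⟩⟩ := Finite.exists_equiv_fin b
      exact ⟨Set.Iio k, isLowerSet_Iio k,
        ⟨e.trans (Fin.equivSubtype (n := k))⟩⟩
    | inr h =>
      obtain ⟨hd⟩ := nonempty_denumerable_iff.2 ⟨hcount, h⟩
      exact ⟨Set.univ, isLowerSet_univ, ⟨(Denumerable.eqv b).trans (Equiv.Set.univ ℕ).symm⟩⟩
  refine ⟨I, hI, ⟨((Module.Basis.span hli).reindex e).map (LinearEquiv.ofEq _ _ ?_)⟩⟩
  rw [Subtype.range_coe_subtype, Set.ofPred_mem_eq, hspan]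

theorem linearIndependent_coe_basis {K V ι : Type*} [Ring K] [AddCommGroup V] [Module K V]
    {W : Submodule K V} (ω : Module.Basis ι K W) : LinearIndependent K fun r => (ω r : V) :=
  ω.linearIndependent.map' W.subtype W.ker_subtype

theorem span_range_coe_basis {K V ι : Type*} [Ring K] [AddCommGroup V] [Module K V]
    {W : Submodule K V} (ω : Module.Basis ι K W) :
    Submodule.span K (Set.range fun r => (ω r : V)) = W := by
  have h1 := congrArg (Submodule.map W.subtype) ω.span_eq
  rwa [Submodule.map_span, ← Set.range_comp, Submodule.map_subtype_top] at h1

/-- The value at the character `ψ` of the trigonometric polynomial with coefficients `c`. -/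
def charSum {V : Type*} [AddCommGroup V] (c : V →₀ ℂ) (ψ : AddChar V Circle) : ℂ :=
  Finsupp.linearCombination ℂ (fun μ => (ψ μ : ℂ)) c

/-- The exponential sum `∑ c(μ) exp(i⟨z, μ⟩)`. -/
def expSum {n : ℕ} (c : (Fin n → ℝ) →₀ ℂ) (z : Fin n → ℂ) : ℂ :=
  Finsupp.linearCombination ℂ (fun μ => Complex.exp (Complex.I * pairing z μ)) c

theorem charSum_eq_sum {V : Type*} [AddCommGroup V] (c : V →₀ ℂ) (ψ : AddChar V Circle) :
    charSum c ψ = ∑ μ ∈ c.support, c μ * ψ μ := rfl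

theorem expSum_eq_sum {n : ℕ} (c : (Fin n → ℝ) →₀ ℂ) (z : Fin n → ℂ) :
    expSum c z = ∑ μ ∈ c.support, c μ * Complex.exp (Complex.I * pairing z μ) := rfl

theorem expSum_sub {n : ℕ} (c d : (Fin n → ℝ) →₀ ℂ) (z : Fin n → ℂ) :
    expSum (c - d) z = expSum c z - expSum d z := map_sub _ _ _

/-- The weight `∏_r (1 - |ν_r| / (j!)²)`. -/
def fejerWeight {I : Set ℕ} (j : ℕ) (ν : firstIndices I j → ℤ) : ℝ :=
  ∏ r, (1 - |(ν r : ℝ)| / (j.factorial : ℝ) ^ 2)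

/-- The coefficients of the Bochner-Fejér kernel. -/
def fejerCoeff {n : ℕ} {I : Set ℕ} (ω : I → (Fin n → ℝ)) (j : ℕ) : (Fin n → ℝ) →₀ ℂ :=
  ∑ ν ∈ fejerTuples I j, Finsupp.single (fejerFrequency ω j ν) (fejerWeight j ν : ℂ)

/-- A finite family of coefficients defining a trigonometric polynomial that is nonnegative at
every character and has mean `1`. -/
structure IsPositiveKernel {V : Type*} [AddCommGroup V] (c : V →₀ ℂ) : Prop where
  zero : c 0 = 1
  pos : ∀ ψ : AddChar V Circle, charSum c ψ = (‖charSum c ψ‖ : ℂ)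

theorem card_filter_sub_eq (N : ℕ) (k : ℤ) (hk : k ∈ Finset.Icc (-(N : ℤ)) N) :
    (((Finset.range N ×ˢ Finset.range N).filter fun p => (p.1 : ℤ) - p.2 = k).card : ℤ) =
      N - |k| := by
  have h : (Finset.range N ×ˢ Finset.range N).filter (fun p => (p.1 : ℤ) - p.2 = k) =
      (Finset.range (N - k.natAbs)).image fun b => (b + k.toNat, b + (-k).toNat) := by
    ext ⟨a, b⟩
    simp only [Finset.mem_filter, Finset.mem_product, Finset.mem_range, Finset.mem_image,
      Prod.mk.injEq]
    constructor
    · rintro ⟨⟨h1, h2⟩, h3⟩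
      exact ⟨min a b, by omega, by omega, by omega⟩
    · rintro ⟨x, h1, h2, h3⟩
      omega
  rw [h, Finset.card_image_of_injective _ fun x y hxy => by simpa using congrArg Prod.fst hxy,
    Finset.card_range]
  rw [Finset.mem_Icc] at hk
  rw [Int.abs_eq_natAbs]
  omega

/-- The one-dimensional Fejér kernel is a square. -/
theorem fejer_kernel_eq (N : ℕ) (hN : 0 < N) (ζ : Circle) :
    ∑ k ∈ Finset.Icc (-(N : ℤ)) N, ((1 - |(k : ℝ)| / N : ℝ) : ℂ) * ((ζ ^ k : Circle) : ℂ) =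
      ((‖∑ a ∈ Finset.range N, (ζ : ℂ) ^ a‖ ^ 2 / N : ℝ) : ℂ) := by
  have hN' : (N : ℂ) ≠ 0 := by exact_mod_cast hN.ne'
  have h1 : ((‖∑ a ∈ Finset.range N, (ζ : ℂ) ^ a‖ ^ 2 : ℝ) : ℂ) =
      ∑ p ∈ Finset.range N ×ˢ Finset.range N, ((ζ ^ ((p.1 : ℤ) - p.2) : Circle) : ℂ) := by
    rw [← Complex.normSq_eq_norm_sq, ← Complex.mul_conj, map_sum, Finset.sum_mul_sum,
      Finset.sum_product]
    refine Finset.sum_congr rfl fun a _ => Finset.sum_congr rfl fun b _ => ?_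
    rw [zpow_sub, zpow_natCast, zpow_natCast, Circle.coe_mul, Circle.coe_pow,
      Circle.coe_inv_eq_conj, Circle.coe_pow]
  have h2 : ∑ p ∈ Finset.range N ×ˢ Finset.range N, ((ζ ^ ((p.1 : ℤ) - p.2) : Circle) : ℂ) =
      ∑ k ∈ Finset.Icc (-(N : ℤ)) N, ((N - |(k : ℝ)| : ℝ) : ℂ) * ((ζ ^ k : Circle) : ℂ) := by
    rw [← Finset.sum_fiberwise_of_maps_to (t := Finset.Icc (-(N : ℤ)) N)
      (g := fun p : ℕ × ℕ => (p.1 : ℤ) - p.2)]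
    · refine Finset.sum_congr rfl fun k hk => ?_
      rw [Finset.sum_congr rfl (g := fun _ => ((ζ ^ k : Circle) : ℂ))]
      · rw [Finset.sum_const, nsmul_eq_mul]
        congr 1
        have := card_filter_sub_eq N k hk
        have h3 : ((((Finset.range N ×ˢ Finset.range N).filter
            fun p => (p.1 : ℤ) - p.2 = k).card : ℤ) : ℂ) = ((N - |k| : ℤ) : ℂ) := by rw [this]
        rw [Int.cast_natCast] at h3
        rw [h3]
        rw [← Int.cast_abs, Int.cast_sub, Complex.ofReal_sub, Int.cast_natCast,
          Complex.ofReal_natCast, Complex.ofReal_intCast]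
      · intro p hp
        rw [(Finset.mem_filter.1 hp).2]
    · intro p hp
      simp only [Finset.mem_product, Finset.mem_range] at hp
      rw [Finset.mem_Icc]
      omega
  rw [Complex.ofReal_div, h1, h2, eq_div_iff (by exact_mod_cast hN'), Finset.sum_mul]
  refine Finset.sum_congr rfl fun k _ => ?_
  push_cast
  field_simp

theorem charSum_fejerCoeff {n : ℕ} {I : Set ℕ} (ω : I → (Fin n → ℝ)) (j : ℕ)
    (ψ : AddChar (Fin n → ℝ) Circle) :
    charSum (fejerCoeff ω j) ψ = ((∏ r : firstIndices I j,
      (‖∑ a ∈ Finset.range (j.factorial ^ 2), (ψ ((j.factorial : ℝ)⁻¹ • ω r.1) : ℂ) ^ a‖ ^ 2 /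
        ((j.factorial ^ 2 : ℕ) : ℝ)) : ℝ) : ℂ) := by
  classical
  have hN : 0 < j.factorial ^ 2 := by positivity
  rw [Complex.ofReal_prod]
  simp_rw [← fejer_kernel_eq _ hN]
  rw [Finset.prod_univ_sum, charSum, fejerCoeff, map_sum]
  simp only [fejerTuples, Nat.cast_pow]
  refine Finset.sum_congr rfl fun ν _ => ?_
  rw [Finsupp.linearCombination_single, smul_eq_mul, Finset.prod_mul_distrib, fejerWeight,
    Complex.ofReal_prod]
  congr 1
  have h1 : ψ (fejerFrequency ω j ν) =
      ∏ r : firstIndices I j, ψ (ν r • ((j.factorial : ℝ)⁻¹ • ω r.1)) := by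
    have h2 := map_prod ψ.toMonoidHom (fun r : firstIndices I j =>
      Multiplicative.ofAdd (ν r • ((j.factorial : ℝ)⁻¹ • ω r.1))) Finset.univ
    rw [← ofAdd_sum] at h2
    refine Eq.trans ?_ h2
    change _ = ψ _
    congr 1
    refine Finset.sum_congr rfl fun r _ => ?_
    rw [← Int.cast_smul_eq_zsmul ℝ, smul_smul, div_eq_mul_inv]
  rw [h1]
  simp only [AddChar.map_zsmul_eq_zpow]
  exact map_prod Circle.coeHom _ _

theorem fejerFrequency_injective {n : ℕ} {I : Set ℕ} {ω : I → (Fin n → ℝ)}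
    (hω : LinearIndependent ℚ ω) (j : ℕ) :
    Function.Injective (fejerFrequency (n := n) ω j) := by
  have hli : LinearIndependent ℚ fun r : firstIndices I j => ω r.1 :=
    hω.comp _ Subtype.val_injective
  rw [Fintype.linearIndependent_iff] at hli
  intro ν ν' h
  funext r
  have h1 := hli (fun r => ((ν r - ν' r : ℤ) : ℚ) / j.factorial) (by
    have h2 : fejerFrequency ω j ν - fejerFrequency ω j ν' = 0 := sub_eq_zero.2 h
    rw [← h2, fejerFrequency, fejerFrequency, ← Finset.sum_sub_distrib]
    refine Finset.sum_congr rfl fun r _ => ?_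
    rw [← sub_smul, ← Rat.cast_smul_eq_qsmul ℝ]
    congr 1
    push_cast
    ring) r
  have h3 : (j.factorial : ℚ) ≠ 0 := by positivity
  rw [div_eq_zero_iff, or_iff_left h3] at h1
  have h4 : ν r - ν' r = 0 := by exact_mod_cast h1
  omega

theorem fejerCoeff_apply {n : ℕ} {I : Set ℕ} {ω : I → (Fin n → ℝ)}
    (hω : LinearIndependent ℚ ω) {j : ℕ} {ν : firstIndices I j → ℤ}
    (hν : ν ∈ fejerTuples I j) :
    fejerCoeff ω j (fejerFrequency ω j ν) = (fejerWeight j ν : ℂ) := by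
  rw [fejerCoeff, Finsupp.finsetSum_apply, Finset.sum_eq_single ν]
  · simp
  · intro ν' _ h
    rw [Finsupp.single_apply, if_neg fun h' => h (fejerFrequency_injective hω j h')]
  · exact fun h => (h hν).elim

theorem isPositiveKernel_fejerCoeff {n : ℕ} {I : Set ℕ} {ω : I → (Fin n → ℝ)}
    (hω : LinearIndependent ℚ ω) (j : ℕ) : IsPositiveKernel (fejerCoeff ω j) where
  zero := by
    have h1 : fejerFrequency ω j 0 = 0 := by simp [fejerFrequency]
    have h2 : (0 : firstIndices I j → ℤ) ∈ fejerTuples I j := by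
      simp only [fejerTuples, Fintype.mem_piFinset, Pi.zero_apply, Finset.mem_Icc]
      intro
      constructor
      · rw [neg_nonpos]; positivity
      · positivity
    rw [← h1, fejerCoeff_apply hω h2]
    simp [fejerWeight]
  pos ψ := by
    rw [charSum_fejerCoeff, Complex.norm_real, Real.norm_eq_abs, abs_of_nonneg]
    exact Finset.prod_nonneg fun r _ => by positivity

/-- The coefficients of the Bochner-Fejér kernels tend to `1` at every frequency in the span of
the basis. -/
theorem tendsto_fejerCoeff {n : ℕ} {I : Set ℕ} {ω : I → (Fin n → ℝ)}
    (hω : LinearIndependent ℚ ω) {μ : Fin n → ℝ}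
    (hμ : μ ∈ Submodule.span ℚ (Set.range ω)) :
    Tendsto (fun j => fejerCoeff ω j μ) atTop (𝓝 1) := by
  classical
  obtain ⟨q, rfl⟩ := Finsupp.mem_span_range_iff_exists_finsupp.1 hμ
  have hfac : Tendsto (fun j : ℕ => (j.factorial : ℝ)) atTop atTop :=
    tendsto_natCast_atTop_atTop.comp factorial_tendsto_atTop
  have hlim : Tendsto (fun j : ℕ =>
      ((∏ r ∈ q.support, (1 - |(q r : ℝ)| / j.factorial) : ℝ) : ℂ)) atTop (𝓝 1) := by
    have h1 : Tendsto (fun j : ℕ => ∏ r ∈ q.support, (1 - |(q r : ℝ)| / j.factorial)) atTop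
        (𝓝 (∏ r ∈ q.support, (1 - 0 : ℝ))) := by
      refine tendsto_finsetProd _ fun r _ => ?_
      exact tendsto_const_nhds.sub (tendsto_const_nhds.div_atTop hfac)
    simp only [sub_zero, Finset.prod_const_one] at h1
    have h2 := (Complex.continuous_ofReal.tendsto 1).comp h1
    rw [Complex.ofReal_one] at h2
    exact h2
  refine hlim.congr' ?_
  have hev : ∀ᶠ j : ℕ in atTop, ∀ r ∈ q.support, r ∈ firstIndices I j ∧
      (q r).den ∣ j.factorial ∧ |(q r : ℝ)| ≤ j.factorial := by
    rw [Finset.eventually_all]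
    intro r _
    filter_upwards [eventually_gt_atTop r.1, eventually_ge_atTop (q r).den,
      hfac.eventually_ge_atTop |(q r : ℝ)|] with j h1 h2 h3
    exact ⟨by simpa [firstIndices] using h1, Nat.dvd_factorial (q r).pos h2, h3⟩
  filter_upwards [hev] with j hj
  have hf : (j.factorial : ℝ) ≠ 0 := by positivity
  -- `μ` is the frequency `∑ m_r ω_r / j!`, with integers `m_r` in the range of the Fejér sum
  have hm : ∀ r : I, ∃ m : ℤ, (m : ℝ) = q r * j.factorial := by
    intro r
    by_cases hr : r ∈ q.support
    · obtain ⟨d, hd⟩ := (hj r hr).2.1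
      refine ⟨(q r).num * d, ?_⟩
      have h1 : ((q r : ℚ) : ℝ) * (q r).den = (q r).num := by
        exact_mod_cast Rat.mul_den_eq_num (q r)
      rw [hd]
      push_cast
      rw [← h1]
      ring
    · refine ⟨0, ?_⟩
      rw [Finsupp.notMem_support_iff.1 hr]
      simp
  choose m hm using hm
  have hfreq : fejerFrequency ω j (fun r => m r.1) = q.sum fun r a => a • ω r := by
    rw [fejerFrequency, Finsupp.sum,
      Finset.sum_coe_sort (firstIndices I j) (fun r => ((m r : ℝ) / (j.factorial : ℝ)) • ω r)]
    symm
    refine (Finset.sum_congr rfl fun r _ => ?_).trans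
      (Finset.sum_subset (fun r hr => (hj r hr).1) fun r _ hr => ?_)
    · rw [hm, mul_div_cancel_right₀ _ hf, Rat.cast_smul_eq_qsmul]
    · rw [hm, Finsupp.notMem_support_iff.1 hr]
      simp
  have hmem : (fun r : firstIndices I j => m r.1) ∈ fejerTuples I j := by
    simp only [fejerTuples, Fintype.mem_piFinset]
    intro r
    rw [Finset.mem_Icc, ← abs_le]
    have h1 : |(m r.1 : ℝ)| ≤ (j.factorial : ℝ) ^ 2 := by
      rw [hm, abs_mul, Nat.abs_cast, sq]
      refine mul_le_mul_of_nonneg_right ?_ (by positivity)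
      by_cases hr : r.1 ∈ q.support
      · exact (hj _ hr).2.2
      · rw [Finsupp.notMem_support_iff.1 hr]
        simp
    exact_mod_cast h1
  rw [← hfreq, fejerCoeff_apply hω hmem, fejerWeight,
    Finset.prod_coe_sort (firstIndices I j) (fun r => (1 - |(m r : ℝ)| / (j.factorial : ℝ) ^ 2))]
  congr 1
  refine (Finset.prod_congr rfl fun r _ => ?_).trans
    (Finset.prod_subset (fun r hr => (hj r hr).1) fun r _ hr => ?_)
  · rw [hm, abs_mul, Nat.abs_cast]
    field_simp
  · rw [hm, Finsupp.notMem_support_iff.1 hr]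
    simp

theorem exists_isPositiveKernel {n : ℕ} (Λ : Finset (Fin n → ℝ)) {η : ℝ} (hη : 0 < η) :
    ∃ c : (Fin n → ℝ) →₀ ℂ, IsPositiveKernel c ∧ ∀ μ ∈ Λ, ‖2 - c μ - c (-μ)‖ ≤ η := by
  obtain ⟨I, -, ⟨ω⟩⟩ := exists_basis_of_countable Λ.countable_toSet
  have hli := linearIndependent_coe_basis ω
  have hspan := span_range_coe_basis ω
  have hev : ∀ᶠ j in atTop, ∀ μ ∈ Λ, ‖2 - fejerCoeff (fun r => (ω r : Fin n → ℝ)) j μ -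
      fejerCoeff (fun r => (ω r : Fin n → ℝ)) j (-μ)‖ ≤ η := by
    rw [Finset.eventually_all]
    intro μ hμ
    have hμ' : μ ∈ Submodule.span ℚ (Set.range fun r => (ω r : Fin n → ℝ)) := by
      rw [hspan]
      exact Submodule.subset_span hμ
    have h1 := (tendsto_const_nhds (x := (2 : ℂ))).sub (tendsto_fejerCoeff hli hμ')
    have h2 := (h1.sub (tendsto_fejerCoeff hli (neg_mem hμ'))).norm
    norm_num at h2
    exact (h2.eventually (gt_mem_nhds hη)).mono fun j hj => hj.le
  obtain ⟨j, hj⟩ := hev.exists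
  exact ⟨_, isPositiveKernel_fejerCoeff hli j, hj⟩

/-- The character `μ ↦ χ(μ) exp(-i⟨t, μ⟩)`. -/
def twist {n : ℕ} (χ : AddChar (Fin n → ℝ) Circle) (t : Fin n → ℝ) :
    AddChar (Fin n → ℝ) Circle :=
  χ * (phase t)⁻¹

theorem twist_apply {n : ℕ} (χ : AddChar (Fin n → ℝ) Circle) (t μ : Fin n → ℝ) :
    (twist χ t μ : ℂ) = χ μ * phase t (-μ) := by
  rw [twist, AddChar.mul_apply, AddChar.inv_apply, Circle.coe_mul]

theorem norm_twist_sub_one {n : ℕ} (χ : AddChar (Fin n → ℝ) Circle) (t μ : Fin n → ℝ) :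
    ‖(twist χ t μ : ℂ) - 1‖ = ‖(phase t μ : ℂ) - χ μ‖ := by
  have h1 : (phase t (-μ) : ℂ) * phase t μ = 1 := by
    rw [← Circle.coe_mul, ← AddChar.map_add_eq_mul, neg_add_cancel, AddChar.map_zero_eq_one,
      Circle.coe_one]
  have h2 : ((twist χ t μ : ℂ) - 1) * phase t μ = -((phase t μ : ℂ) - χ μ) := by
    rw [twist_apply]
    linear_combination (χ μ : ℂ) * h1
  have h3 := congrArg norm h2
  rwa [norm_mul, Circle.norm_coe, mul_one, norm_neg] at h3

theorem continuous_twist {n : ℕ} (χ : AddChar (Fin n → ℝ) Circle) (μ : Fin n → ℝ) :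
    Continuous fun t => (twist χ t μ : ℂ) := by
  simp only [twist_apply]
  exact continuous_const.mul (continuous_phase _)

theorem continuous_charSum_twist {n : ℕ} (χ : AddChar (Fin n → ℝ) Circle)
    (c : (Fin n → ℝ) →₀ ℂ) : Continuous fun t => charSum c (twist χ t) := by
  simp only [charSum_eq_sum]
  exact continuous_finsetSum _ fun μ _ => continuous_const.mul (continuous_twist χ μ)

theorem hasMean_charSum_twist_mul {n : ℕ} {l : Filter ℝ} (hl : l ≤ atTop)
    (χ : AddChar (Fin n → ℝ) Circle) (c : (Fin n → ℝ) →₀ ℂ) (μ : Fin n → ℝ) :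
    HasMean l (fun t => charSum c (twist χ t) * twist χ t μ) (c (-μ)) := by
  classical
  have h1 : ∀ ν ∈ c.support, HasMean l (fun t => (c ν * χ (ν + μ)) * (phase t (-(ν + μ)) : ℂ))
      ((c ν * χ (ν + μ)) * if -(ν + μ) = 0 then 1 else 0) := fun ν _ =>
    (hasMean_phase hl (-(ν + μ))).const_mul _
  have h2 := HasMean.sum c.support
    (φ := fun ν t => (c ν * χ (ν + μ)) * (phase t (-(ν + μ)) : ℂ))
    (fun ν _ => continuous_const.mul (continuous_phase (-(ν + μ)))) h1
  have h3 : ∑ ν ∈ c.support, (c ν * χ (ν + μ)) * (if -(ν + μ) = 0 then 1 else 0) = c (-μ) := by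
    rw [Finset.sum_eq_single (-μ)]
    · simp
    · intro ν _ hν
      rw [if_neg, mul_zero]
      intro h
      exact hν (eq_neg_of_add_eq_zero_left (neg_eq_zero.1 h))
    · intro h
      simp [Finsupp.notMem_support_iff.1 h]
  rw [h3] at h2
  convert h2 using 2 with t
  rw [charSum_eq_sum, Finset.sum_mul]
  refine Finset.sum_congr rfl fun ν _ => ?_
  rw [mul_assoc, ← Circle.coe_mul, ← AddChar.map_add_eq_mul, twist_apply, mul_assoc]

namespace IsPositiveKernel

variable {n : ℕ} {l : Filter ℝ} {c : (Fin n → ℝ) →₀ ℂ}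

theorem hasMean_norm (hl : l ≤ atTop) (hc : IsPositiveKernel c)
    (χ : AddChar (Fin n → ℝ) Circle) :
    HasMean l (fun t => (‖charSum c (twist χ t)‖ : ℂ)) 1 := by
  have h := hasMean_charSum_twist_mul hl χ c 0
  rw [neg_zero, hc.zero] at h
  convert h using 2 with t
  rw [← hc.pos, AddChar.map_zero_eq_one, Circle.coe_one, mul_one]

/-- The mass that a positive kernel puts on the characters far from `1` at `μ` is controlled by its
coefficients at `μ` and `-μ`. -/
theorem hasMean_norm_mul_sq (hl : l ≤ atTop) (hc : IsPositiveKernel c)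
    (χ : AddChar (Fin n → ℝ) Circle) (μ : Fin n → ℝ) :
    HasMean l (fun t => ((‖charSum c (twist χ t)‖ * ‖(twist χ t μ : ℂ) - 1‖ ^ 2 : ℝ) : ℂ))
      (2 - c μ - c (-μ)) := by
  have h0 := (hc.hasMean_norm hl χ).const_mul 2
  have h1 := hasMean_charSum_twist_mul hl χ c μ
  have h2 := hasMean_charSum_twist_mul hl χ c (-μ)
  rw [neg_neg] at h2
  have hcont := continuous_charSum_twist χ c
  have hcn : Continuous fun t => (2 : ℂ) * (‖charSum c (twist χ t)‖ : ℂ) :=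
    continuous_const.mul (Complex.continuous_ofReal.comp hcont.norm)
  have h3 := (h0.sub hcn (hcont.mul (continuous_twist χ (-μ))) h2).sub
    (hcn.sub (hcont.mul (continuous_twist χ (-μ)))) (hcont.mul (continuous_twist χ μ)) h1
  rw [mul_one] at h3
  convert h3 using 2 with t
  have h4 : ((‖(twist χ t μ : ℂ) - 1‖ ^ 2 : ℝ) : ℂ) =
      2 - twist χ t (-μ) - twist χ t μ := by
    rw [← Complex.normSq_eq_norm_sq, ← Complex.mul_conj, AddChar.map_neg_eq_inv,
      Circle.coe_inv_eq_conj]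
    have h5 : (twist χ t μ : ℂ) * (starRingEnd ℂ) (twist χ t μ : ℂ) = 1 := by
      rw [Complex.mul_conj, Circle.normSq_coe, Complex.ofReal_one]
    rw [map_sub, map_one]
    linear_combination h5
  simp only [Pi.sub_apply, Pi.mul_apply]
  rw [Complex.ofReal_mul, h4, ← hc.pos]
  ring

end IsPositiveKernel

/-- **Kronecker's theorem**, finitary form: on finitely many frequencies every character of `ℝⁿ`
is approximated by continuous characters. -/
theorem exists_phase_near {n : ℕ} (χ : AddChar (Fin n → ℝ) Circle) (Λ : Finset (Fin n → ℝ))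
    {δ : ℝ} (hδ : 0 < δ) : ∃ t : Fin n → ℝ, ∀ μ ∈ Λ, ‖(phase t μ : ℂ) - χ μ‖ < δ := by
  by_contra hcon
  push Not at hcon
  obtain ⟨c, hc, hcΛ⟩ := exists_isPositiveKernel Λ
    (show 0 < δ ^ 2 / (2 * (Λ.card + 1)) by positivity)
  have hcont := continuous_charSum_twist χ c
  -- were all `phase t` far from `χ` on `Λ`, the mean of the kernel times the squared distance would
  -- be at least `δ²`
  have h1 := HasMean.sum (l := atTop) Λ
    (φ := fun μ t => ((‖charSum c (twist χ t)‖ * ‖(twist χ t μ : ℂ) - 1‖ ^ 2 : ℝ) : ℂ))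
    (fun μ _ => Complex.continuous_ofReal.comp
      (hcont.norm.mul (((continuous_twist χ μ).sub continuous_const).norm.pow 2)))
    (fun μ _ => hc.hasMean_norm_mul_sq le_rfl χ μ)
  have h2 := (hc.hasMean_norm le_rfl χ).const_mul ((δ ^ 2 : ℝ) : ℂ)
  have h3 := HasMean.norm_le
    (k := fun t => ∑ μ ∈ Λ, ‖charSum c (twist χ t)‖ * ‖(twist χ t μ : ℂ) - 1‖ ^ 2)
    (b := ∑ μ ∈ Λ, (2 - c μ - c (-μ)))
    (continuous_finsetSum _ fun μ _ =>
      hcont.norm.mul (((continuous_twist χ μ).sub continuous_const).norm.pow 2))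
    (fun t => ?_) h2 (by simpa only [Complex.ofReal_sum] using h1)
  · rw [mul_one, Complex.norm_real, Real.norm_eq_abs, abs_of_pos (by positivity)] at h3
    have h4 : ‖∑ μ ∈ Λ, (2 - c μ - c (-μ))‖ ≤ Λ.card * (δ ^ 2 / (2 * (Λ.card + 1))) := by
      refine (norm_sum_le _ _).trans ?_
      rw [← nsmul_eq_mul]
      exact Finset.sum_le_card_nsmul _ _ _ hcΛ
    have h5 : Λ.card * (δ ^ 2 / (2 * (Λ.card + 1))) ≤ δ ^ 2 / 2 := by
      rw [mul_div_assoc', div_le_div_iff₀ (by positivity) (by positivity)]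
      nlinarith [sq_nonneg δ]
    have h6 : 0 < δ ^ 2 := by positivity
    linarith
  · obtain ⟨μ, hμ, hd⟩ := hcon t
    have h4 : ‖charSum c (twist χ t)‖ * ‖(twist χ t μ : ℂ) - 1‖ ^ 2 ≤
        ∑ μ ∈ Λ, ‖charSum c (twist χ t)‖ * ‖(twist χ t μ : ℂ) - 1‖ ^ 2 :=
      Finset.single_le_sum (f := fun μ => ‖charSum c (twist χ t)‖ * ‖(twist χ t μ : ℂ) - 1‖ ^ 2)
        (fun μ _ => by positivity) hμ
    refine le_trans ?_ h4
    rw [norm_mul, Complex.norm_real, Complex.norm_real, norm_norm, Real.norm_eq_abs,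
      abs_of_pos (by positivity), mul_comm, norm_twist_sub_one]
    gcongr

/-- **Kronecker's theorem**: the continuous characters are dense in the group of all characters
of `ℝⁿ`, for the topology of pointwise convergence. -/
theorem exists_filter_tendsto_phase {n : ℕ} (χ : AddChar (Fin n → ℝ) Circle) :
    ∃ V : Filter (Fin n → ℝ), NeBot V ∧ ∀ μ, Tendsto (fun t => phase t μ) V (𝓝 (χ μ)) := by
  classical
  choose t ht using fun p : Finset (Fin n → ℝ) × ℕ =>
    exists_phase_near χ p.1 (Nat.one_div_pos_of_nat (α := ℝ) (n := p.2))
  refine ⟨map t atTop, inferInstance, fun μ => ?_⟩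
  rw [tendsto_map'_iff, Metric.tendsto_atTop]
  intro ε hε
  obtain ⟨k, hk⟩ := exists_nat_one_div_lt hε
  refine ⟨({μ}, k), fun p hp => ?_⟩
  have h1 : μ ∈ p.1 := hp.1 (Finset.mem_singleton_self μ)
  have h2 := ht p μ h1
  change dist ((phase (t p) μ : Circle) : ℂ) (χ μ) < ε
  rw [dist_eq_norm]
  refine h2.trans (lt_of_le_of_lt ?_ hk)
  exact one_div_le_one_div_of_le (by positivity) (by exact_mod_cast Nat.succ_le_succ hp.2)

/-! ### Holomorphic almost periodic functions and their means -/

/-- A scalar holomorphic almost periodic function on the tube; compact subsets `C` of `Ω` replace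
the sets `Ω' ⋐ Ω`, and cubes replace boxes. -/
structure IsHolomorphicAP {n : ℕ} {Ω : Set (Fin n → ℝ)} (f : tube Ω → ℂ) : Prop where
  holomorphic : ∃ g : (Fin n → ℂ) → ℂ, DifferentiableOn ℂ g (tube Ω) ∧ ∀ z : tube Ω, g z.1 = f z
  almostPeriodic : ∀ ε : ℝ, 0 < ε → ∀ C : Set (Fin n → ℝ), IsCompact C → C ⊆ Ω →
    ∃ R : ℝ, ∀ ξ : Fin n → ℝ, ∃ τ : Fin n → ℝ, (∀ k, |τ k - ξ k| < R) ∧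
      ∀ z ∈ subtube Ω C, ‖f (shift τ z) - f z‖ ≤ ε

/-- The inclusion `ℝⁿ ⊆ ℂⁿ`. -/
def ofReals {n : ℕ} (t : Fin n → ℝ) : Fin n → ℂ := fun k => (t k : ℂ)

theorem continuous_ofReals {n : ℕ} : Continuous (ofReals (n := n)) :=
  continuous_pi fun k => Complex.continuous_ofReal.comp (continuous_apply k)

theorem coe_shift {n : ℕ} {Ω : Set (Fin n → ℝ)} (t : Fin n → ℝ) (z : tube Ω) :
    (shift t z).1 = z.1 + ofReals t := rfl

theorem shift_add {n : ℕ} {Ω : Set (Fin n → ℝ)} (s t : Fin n → ℝ) (z : tube Ω) :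
    shift (s + t) z = shift s (shift t z) := by
  apply Subtype.ext
  funext k
  simp only [shift, Pi.add_apply]
  push_cast
  ring

theorem shift_neg_shift {n : ℕ} {Ω : Set (Fin n → ℝ)} (t : Fin n → ℝ) (z : tube Ω) :
    shift t (shift (-t) z) = z := by
  apply Subtype.ext
  funext k
  simp [shift]

theorem isOpen_tube {n : ℕ} {Ω : Set (Fin n → ℝ)} (hΩ : IsOpen Ω) : IsOpen (tube Ω) :=
  hΩ.preimage (continuous_pi fun k => Complex.continuous_im.comp (continuous_apply k))

theorem add_ofReals_mem_tube {n : ℕ} {Ω : Set (Fin n → ℝ)} {z : Fin n → ℂ} (hz : z ∈ tube Ω)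
    (t : Fin n → ℝ) : z + ofReals t ∈ tube Ω :=
  (shift t (⟨z, hz⟩ : tube Ω)).2

theorem mem_subtube_iff {n : ℕ} {Ω C : Set (Fin n → ℝ)} {z : tube Ω} :
    z ∈ subtube Ω C ↔ (fun k => (z.1 k).im) ∈ C := Iff.rfl

/-- The part of a tube with compact base that lies over a cube is compact. -/
theorem isCompact_cube_tube {n : ℕ} {C : Set (Fin n → ℝ)} (hC : IsCompact C) (R : ℝ) :
    IsCompact {w : Fin n → ℂ | (∀ k, |(w k).re| ≤ R) ∧ w ∈ tube C} := by
  have h : {w : Fin n → ℂ | (∀ k, |(w k).re| ≤ R) ∧ w ∈ tube C} =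
      (fun p : (Fin n → ℝ) × (Fin n → ℝ) => fun k => ((p.1 k : ℂ) + Complex.I * p.2 k)) ''
        (Set.Icc (fun _ => -R) (fun _ => R) ×ˢ C) := by
    ext w
    constructor
    · rintro ⟨h1, h2⟩
      refine ⟨(fun k => (w k).re, fun k => (w k).im),
        ⟨⟨fun k => (abs_le.1 (h1 k)).1, fun k => (abs_le.1 (h1 k)).2⟩, h2⟩, ?_⟩
      funext k
      apply Complex.ext <;> simp
    · rintro ⟨⟨x, y⟩, ⟨hx, hy⟩, rfl⟩
      refine ⟨fun k => ?_, ?_⟩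
      · simpa using abs_le.2 ⟨hx.1 k, hx.2 k⟩
      · have : (fun k => ((x k : ℂ) + Complex.I * y k).im) = y := by
          funext k; simp
        change (fun k => ((x k : ℂ) + Complex.I * y k).im) ∈ C
        rw [this]
        exact hy
  rw [h]
  refine (isCompact_Icc.prod hC).image ?_
  fun_prop

section AlmostPeriods

variable {n : ℕ} {Ω : Set (Fin n → ℝ)}

/-- The `ε`-almost periods of `f` on the subtube with base `C`. -/
def almostPeriods (f : tube Ω → ℂ) (C : Set (Fin n → ℝ)) (ε : ℝ) : Set (Fin n → ℝ) :=
  {τ | ∀ z ∈ subtube Ω C, ‖f (shift τ z) - f z‖ ≤ ε}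

theorem add_mem_almostPeriods {f : tube Ω → ℂ} {C : Set (Fin n → ℝ)} {ε ε' : ℝ}
    {s t : Fin n → ℝ} (hs : s ∈ almostPeriods f C ε) (ht : t ∈ almostPeriods f C ε') :
    s + t ∈ almostPeriods f C (ε + ε') := by
  intro z hz
  rw [shift_add]
  have h1 := hs (shift t z) (shift_mem_subtube t hz)
  have h2 := ht z hz
  calc ‖f (shift s (shift t z)) - f z‖
      = ‖(f (shift s (shift t z)) - f (shift t z)) + (f (shift t z) - f z)‖ := by ring_nf
    _ ≤ _ := norm_add_le _ _
    _ ≤ _ := add_le_add h1 h2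

theorem neg_mem_almostPeriods {f : tube Ω → ℂ} {C : Set (Fin n → ℝ)} {ε : ℝ}
    {s : Fin n → ℝ} (hs : s ∈ almostPeriods f C ε) : -s ∈ almostPeriods f C ε := by
  intro z hz
  have h1 := hs (shift (-s) z) (shift_mem_subtube _ hz)
  rw [shift_neg_shift] at h1
  rwa [norm_sub_rev]

end AlmostPeriods

namespace IsHolomorphicAP

variable {n : ℕ} {Ω : Set (Fin n → ℝ)} {f : tube Ω → ℂ}

theorem continuous_shift (hf : IsHolomorphicAP f) (z : tube Ω) :
    Continuous fun t => f (shift t z) := by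
  obtain ⟨g, hg, hgf⟩ := hf.holomorphic
  simp only [← hgf, coe_shift]
  exact hg.continuousOn.comp_continuous (continuous_const.add continuous_ofReals)
    fun t => (shift t z).2

theorem bounded (hf : IsHolomorphicAP f) {C : Set (Fin n → ℝ)} (hC : IsCompact C)
    (hCΩ : C ⊆ Ω) : ∃ B : ℝ, 0 ≤ B ∧ ∀ z ∈ subtube Ω C, ‖f z‖ ≤ B := by
  obtain ⟨g, hg, hgf⟩ := hf.holomorphic
  obtain ⟨R, hR⟩ := hf.almostPeriodic 1 one_pos C hC hCΩ
  obtain ⟨B, hB⟩ := (isCompact_cube_tube hC R).exists_bound_of_continuousOn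
    (hg.continuousOn.mono fun w hw => hCΩ hw.2)
  refine ⟨max B 0 + 1, by positivity, fun z hz => ?_⟩
  obtain ⟨τ, hτ, hd⟩ := hR fun k => -(z.1 k).re
  have h1 : ‖f (shift τ z)‖ ≤ B := by
    rw [← hgf]
    refine hB _ ⟨fun k => ?_, shift_mem_subtube τ hz⟩
    have h2 := (hτ k).le
    have h3 : ((shift τ z).1 k).re = τ k - -(z.1 k).re := by
      simp [shift, add_comm]
    rw [h3]
    exact h2
  have h2 := hd z hz
  have h3 := norm_sub_le (f (shift τ z)) (f (shift τ z) - f z)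
  rw [sub_sub_cancel] at h3
  have := le_max_left B 0
  linarith

theorem uniformly_continuous (hf : IsHolomorphicAP f) {C : Set (Fin n → ℝ)} (hC : IsCompact C)
    (hCΩ : C ⊆ Ω) {ε : ℝ} (hε : 0 < ε) :
    ∃ δ > 0, ∀ τ : Fin n → ℝ, (∀ k, |τ k| ≤ δ) → τ ∈ almostPeriods f C ε := by
  obtain ⟨g, hg, hgf⟩ := hf.holomorphic
  obtain ⟨R, hR⟩ := hf.almostPeriodic (ε / 3) (by positivity) C hC hCΩ
  have huc := (isCompact_cube_tube hC (R + 1)).uniformContinuousOn_of_continuous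
    (hg.continuousOn.mono fun w hw => hCΩ hw.2)
  obtain ⟨δ, hδ, hd⟩ := Metric.uniformContinuousOn_iff.1 huc (ε / 3) (by positivity)
  refine ⟨min (δ / 2) 1, by positivity, fun τ hτ z hz => ?_⟩
  obtain ⟨p, hp, hpd⟩ := hR fun k => -(z.1 k).re
  have hre : ∀ k, |((shift p z).1 k).re| < R := by
    intro k
    have h3 : ((shift p z).1 k).re = p k - -(z.1 k).re := by
      simp [shift, add_comm]
    rw [h3]
    exact hp k
  have h1 : (shift p z).1 ∈ {w : Fin n → ℂ | (∀ k, |(w k).re| ≤ R + 1) ∧ w ∈ tube C} :=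
    ⟨fun k => by linarith [hre k], shift_mem_subtube p hz⟩
  have h2 : (shift τ (shift p z)).1 ∈
      {w : Fin n → ℂ | (∀ k, |(w k).re| ≤ R + 1) ∧ w ∈ tube C} := by
    refine ⟨fun k => ?_, shift_mem_subtube τ (shift_mem_subtube p hz)⟩
    have h3 : ((shift τ (shift p z)).1 k).re = ((shift p z).1 k).re + τ k := by
      simp [shift]
    rw [h3]
    refine (abs_add_le _ _).trans ?_
    have := (hτ k).trans (min_le_right _ _)
    linarith [hre k]
  have h3 : dist (shift τ (shift p z)).1 (shift p z).1 < δ := by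
    refine lt_of_le_of_lt ?_ (half_lt_self hδ)
    rw [dist_pi_le_iff (by positivity)]
    intro k
    rw [dist_eq_norm]
    have h4 : (shift τ (shift p z)).1 k - (shift p z).1 k = (τ k : ℂ) := by
      simp [shift]
    rw [h4, Complex.norm_real]
    exact (hτ k).trans (min_le_left _ _)
  have h4 := (hd _ h2 _ h1 h3).le
  rw [dist_eq_norm, hgf, hgf] at h4
  have h5 := hpd z hz
  have h6 := hpd (shift τ z) (shift_mem_subtube τ hz)
  rw [shift_shift_comm] at h6
  calc ‖f (shift τ z) - f z‖ = ‖(f (shift τ (shift p z)) - f (shift p z)) +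
        (f (shift p z) - f z) - (f (shift τ (shift p z)) - f (shift τ z))‖ := by ring_nf
    _ ≤ ‖f (shift τ (shift p z)) - f (shift p z)‖ + ‖f (shift p z) - f z‖ +
        ‖f (shift τ (shift p z)) - f (shift τ z)‖ :=
      (norm_sub_le _ _).trans (add_le_add_left (norm_add_le _ _) _)
    _ ≤ ε := by linarith

/-- The `ε`-almost periods contain a Bohr neighbourhood of zero. -/
theorem exists_bohr_set (hf : IsHolomorphicAP f) {C : Set (Fin n → ℝ)} (hC : IsCompact C)
    (hCΩ : C ⊆ Ω) {ε : ℝ} (hε : 0 < ε) :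
    ∃ (Λ : Finset (Fin n → ℝ)) (δ : ℝ), 0 < δ ∧
      ∀ τ : Fin n → ℝ, (∀ μ ∈ Λ, ‖(phase τ μ : ℂ) - 1‖ < δ) → τ ∈ almostPeriods f C ε := by
  obtain ⟨u, hu, huc⟩ := hf.uniformly_continuous hC hCΩ (show 0 < ε / 5 by positivity)
  obtain ⟨R, hR⟩ := hf.almostPeriodic (ε / 5) (by positivity) C hC hCΩ
  obtain ⟨Λ, δ, hδ, h⟩ := exists_bohr_set_of_relatively_dense
    (P := almostPeriods f C (ε / 5)) (R := R)
    (fun ξ => let ⟨τ, h1, h2⟩ := hR ξ; ⟨τ, h2, h1⟩) hu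
  refine ⟨Λ, δ, hδ, fun τ hτ => ?_⟩
  obtain ⟨a, ha, b, hb, c, hc, d, hd, he⟩ := h τ hτ
  -- `τ` is a signed sum of four almost periods and a short vector
  have h1 := add_mem_almostPeriods (add_mem_almostPeriods (add_mem_almostPeriods
    (add_mem_almostPeriods ha hb) (neg_mem_almostPeriods hc)) (neg_mem_almostPeriods hd))
    (huc (τ - (a + b - c - d)) he)
  have h2 : a + b + -c + -d + (τ - (a + b - c - d)) = τ := by abel
  rw [h2] at h1
  have h3 : ε / 5 + ε / 5 + ε / 5 + ε / 5 + ε / 5 = ε := by ring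
  rwa [h3] at h1

end IsHolomorphicAP

/-- Second-order Taylor estimate for a bounded holomorphic function on a ball. -/
theorem norm_sub_sub_fderiv_le {E : Type*} [NormedAddCommGroup E] [NormedSpace ℂ E]
    {G : E → ℂ} {c : E} {r B : ℝ} (hr : 0 < r) (hG : DifferentiableOn ℂ G (Metric.ball c r))
    (hB : ∀ w ∈ Metric.ball c r, ‖G w‖ ≤ B) {h : E} (hh : ‖h‖ < r) :
    ‖G (c + h) - G c - fderiv ℂ G c h‖ ≤ 4 * B * (‖h‖ / r) ^ 2 := by
  have hc : c ∈ Metric.ball c r := Metric.mem_ball_self hr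
  have hdist : ∀ w ∈ Metric.ball c r, ‖G w - G c‖ ≤ 2 * B := fun w hw =>
    (norm_sub_le _ _).trans (by linarith [hB w hw, hB c hc])
  have hD : ‖fderiv ℂ G c‖ ≤ 2 * B / r := by
    refine Complex.norm_fderiv_le_div_of_mapsTo_ball hG (fun w hw => ?_) hr
    rw [mem_closedBall_iff_norm]
    exact hdist w hw
  -- without its linear part, `G` vanishes to second order
  set u : E → ℂ := fun w => G w - fderiv ℂ G c (w - c) with hu
  have huc : u c = G c := by simp [hu]
  have hdu : DifferentiableOn ℂ u (Metric.ball c r) :=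
    hG.sub ((fderiv ℂ G c).differentiable.comp (differentiable_id.sub_const c)).differentiableOn
  have hmaps : Set.MapsTo u (Metric.ball c r) (Metric.closedBall (u c) (4 * B)) := by
    intro w hw
    rw [mem_closedBall_iff_norm, huc]
    have h1 : u w - G c = (G w - G c) - fderiv ℂ G c (w - c) := by simp only [hu]; ring
    rw [h1]
    have h2 : ‖fderiv ℂ G c (w - c)‖ ≤ 2 * B := by
      refine ((fderiv ℂ G c).le_opNorm _).trans ?_
      have h3 : ‖w - c‖ ≤ r := (mem_ball_iff_norm.1 hw).le
      calc ‖fderiv ℂ G c‖ * ‖w - c‖ ≤ (2 * B / r) * r :=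
            mul_le_mul hD h3 (norm_nonneg _) ((norm_nonneg _).trans hD)
        _ = 2 * B := by field_simp
    exact (norm_sub_le _ _).trans (by linarith [hdist w hw])
  have hlo : (fun w => u w - u c) =o[𝓝 c] fun w => ‖w - c‖ ^ 1 := by
    have h1 := (hG.differentiableAt (Metric.ball_mem_nhds c hr)).hasFDerivAt.isLittleO
    simp only [pow_one]
    refine (h1.congr_left fun w => ?_).norm_right
    rw [huc]
    simp only [hu]
    ring
  have h1 := Complex.dist_le_mul_div_pow_of_mapsTo_ball_of_isLittleO (z := c + h) hdu hmaps hlo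
    (by rwa [mem_ball_iff_norm, add_sub_cancel_left])
  have h2 : u (c + h) - G c = G (c + h) - G c - fderiv ℂ G c h := by
    simp only [hu, add_sub_cancel_left]
    ring
  rwa [dist_eq_norm, dist_eq_norm, huc, add_sub_cancel_left, h2] at h1

/-- Means of a holomorphic function over the horizontal slices of a tube do not depend on the
slice: they do not change under real translations, so by the Cauchy-Riemann equations their
derivative in the imaginary directions vanishes. -/
theorem mean_eq_of_mem_tube {n : ℕ} {Ω : Set (Fin n → ℝ)} (hΩo : IsOpen Ω) (hΩc : Convex ℝ Ω)
    {G : (Fin n → ℂ) → ℂ} (hG : DifferentiableOn ℂ G (tube Ω))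
    (hB : ∀ C : Set (Fin n → ℝ), IsCompact C → C ⊆ Ω → ∃ B, ∀ w ∈ tube C, ‖G w‖ ≤ B)
    {l : Filter ℝ} [NeBot l] (hl : l ≤ atTop) {H : (Fin n → ℂ) → ℂ}
    (hH : ∀ z ∈ tube Ω, HasMean l (fun t => G (z + ofReals t)) (H z))
    {z w : Fin n → ℂ} (hz : z ∈ tube Ω) (hw : w ∈ tube Ω) : H z = H w := by
  have hcont : ∀ z ∈ tube Ω, Continuous fun t => G (z + ofReals t) := fun z hz =>
    hG.continuousOn.comp_continuous (continuous_const.add continuous_ofReals)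
      fun t => add_ofReals_mem_tube hz t
  have htrans : ∀ z ∈ tube Ω, ∀ s, H (z + ofReals s) = H z := by
    intro z hz s
    obtain ⟨B, hB'⟩ := hB {fun k => (z k).im} isCompact_singleton
      (Set.singleton_subset_iff.2 hz)
    have h1 := (hH z hz).translate hl (hcont z hz)
      (fun t => hB' _ (add_ofReals_mem_tube (Ω := {fun k => (z k).im}) rfl t)) s
    refine (hH _ (add_ofReals_mem_tube hz s)).unique ?_
    convert h1 using 2 with t
    congr 1
    funext k
    simp only [Pi.add_apply, ofReals]
    push_cast
    ring
  let p : (Fin n → ℝ) → (Fin n → ℂ) := fun y k => Complex.I * (y k : ℂ)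
  have hp : ∀ y, (fun k => (p y k).im) = y := fun y => by funext k; simp [p]
  have hpΩ : ∀ y ∈ Ω, p y ∈ tube Ω := fun y hy => by
    change (fun k => (p y k).im) ∈ Ω
    rwa [hp]
  have hder : ∀ y ∈ Ω, HasFDerivAt (fun y => H (p y)) (0 : (Fin n → ℝ) →L[ℝ] ℂ) y := by
    intro y hy
    obtain ⟨r, hr, hrΩ⟩ := Metric.isOpen_iff.1 hΩo y hy
    obtain ⟨B, hB'⟩ := hB (Metric.closedBall y (r / 2)) (isCompact_closedBall _ _)
      ((Metric.closedBall_subset_ball (half_lt_self hr)).trans hrΩ)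
    have hr2 : 0 < r / 2 := half_pos hr
    have hball : ∀ t, ∀ w ∈ Metric.ball (p y + ofReals t) (r / 2),
        w ∈ tube (Metric.closedBall y (r / 2)) := by
      intro t w hw
      change (fun k => (w k).im) ∈ Metric.closedBall y (r / 2)
      rw [Metric.mem_closedBall, dist_pi_le_iff hr2.le]
      intro k
      have h1 : dist (w k) ((p y + ofReals t) k) ≤ r / 2 :=
        (dist_le_pi_dist _ _ _).trans (Metric.mem_ball.1 hw).le
      have h2 : (w k).im - y k = (w k - (p y + ofReals t) k).im := by
        simp [p, ofReals]
      rw [Real.dist_eq, h2]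
      exact (Complex.abs_im_le_norm _).trans (by rwa [← dist_eq_norm])
    have hsub : tube (Metric.closedBall y (r / 2)) ⊆ tube Ω := fun w hw =>
      hrΩ (Metric.closedBall_subset_ball (half_lt_self hr) hw)
    -- moving by `iv` changes `G` by `i` times what moving by `v` does, up to second order and
    -- uniformly along the slice; the latter change has mean zero
    have hbound : ∀ v : Fin n → ℝ, ‖v‖ < r / 2 →
        ‖H (p (y + v)) - H (p y)‖ ≤ 8 * B / (r / 2) ^ 2 * ‖v‖ ^ 2 := by
      intro v hv
      have hpv : ‖p v‖ = ‖v‖ := by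
        simp only [p, Pi.norm_def]
        congr 2
        funext k
        apply NNReal.eq
        simp
      have hov : ‖ofReals v‖ = ‖v‖ := by
        simp only [ofReals, Pi.norm_def]
        congr 2
        funext k
        apply NNReal.eq
        simp
      have hpI : p v = Complex.I • ofReals v := rfl
      have hpt : ∀ t, ‖(G (p y + ofReals t + p v) - G (p y + ofReals t)) -
          Complex.I * (G (p y + ofReals t + ofReals v) - G (p y + ofReals t))‖ ≤
          8 * B / (r / 2) ^ 2 * ‖v‖ ^ 2 := by
        intro t
        have hd : DifferentiableOn ℂ G (Metric.ball (p y + ofReals t) (r / 2)) :=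
          hG.mono fun w hw => hsub (hball t w hw)
        have hb : ∀ w ∈ Metric.ball (p y + ofReals t) (r / 2), ‖G w‖ ≤ B := fun w hw =>
          hB' w (hball t w hw)
        have e1 := norm_sub_sub_fderiv_le hr2 hd hb (hpv.trans_lt hv)
        have e2 := norm_sub_sub_fderiv_le hr2 hd hb (hov.trans_lt hv)
        rw [hpI, map_smul, smul_eq_mul, ← hpI, hpv] at e1
        rw [hov] at e2
        set c := p y + ofReals t
        calc ‖(G (c + p v) - G c) - Complex.I * (G (c + ofReals v) - G c)‖
            = ‖(G (c + p v) - G c - Complex.I * fderiv ℂ G c (ofReals v)) -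
              Complex.I * (G (c + ofReals v) - G c - fderiv ℂ G c (ofReals v))‖ := by
              congr 1; ring
          _ ≤ ‖G (c + p v) - G c - Complex.I * fderiv ℂ G c (ofReals v)‖ +
              ‖G (c + ofReals v) - G c - fderiv ℂ G c (ofReals v)‖ := by
              refine (norm_sub_le _ _).trans_eq ?_
              rw [norm_mul, Complex.norm_I, one_mul]
          _ ≤ 4 * B * (‖v‖ / (r / 2)) ^ 2 + 4 * B * (‖v‖ / (r / 2)) ^ 2 := add_le_add e1 e2
          _ = _ := by rw [div_pow]; ring
      have hy0 := hpΩ y hy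
      have hyv : p (y + v) ∈ tube Ω := hpΩ _ (hrΩ (by
        rw [mem_ball_iff_norm, add_sub_cancel_left]
        linarith))
      have hyv' : p (y + v) = p y + p v := by
        funext k
        simp only [p, Pi.add_apply]
        push_cast
        ring
      have m0 := hH _ hy0
      have m1 := hH _ hyv
      have m2 := hH _ (add_ofReals_mem_tube hy0 v)
      have c0 := hcont _ hy0
      have c1 := hcont _ hyv
      have c2 := hcont _ (add_ofReals_mem_tube hy0 v)
      have m3 := (m1.sub c1 c0 m0).sub (c1.sub c0) (continuous_const.mul (c2.sub c0))
        ((m2.sub c2 c0 m0).const_mul Complex.I)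
      rw [htrans _ hy0, sub_self, mul_zero, sub_zero] at m3
      refine m3.norm_le_const hl fun t => ?_
      have := hpt t
      rw [add_right_comm (p y) (ofReals t) (p v), add_right_comm (p y) (ofReals t) (ofReals v),
        ← hyv'] at this
      exact this
    have hO : (fun y' => H (p y') - H (p y)) =O[𝓝 y] fun y' => ‖y' - y‖ ^ 2 := by
      refine Asymptotics.IsBigO.of_bound (8 * B / (r / 2) ^ 2) ?_
      filter_upwards [Metric.ball_mem_nhds y hr2] with y' hy'
      have := hbound (y' - y) (mem_ball_iff_norm.1 hy')
      rw [add_sub_cancel] at this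
      rwa [norm_pow, norm_norm]
    have := hO.hasFDerivAt (𝕜 := ℝ) one_lt_two
    simpa using this.add_const (H (p y))
  have hcst : ∀ y ∈ Ω, ∀ y' ∈ Ω, H (p y) = H (p y') := by
    intro y hy y' hy'
    exact hΩo.is_const_of_fderiv_eq_zero (𝕜 := ℝ) hΩc.isPreconnected
      (fun x hx => (hder x hx).differentiableAt.differentiableWithinAt)
      (fun x hx => (hder x hx).fderiv) hy hy'
  have hdecomp : ∀ z : Fin n → ℂ, z = p (fun k => (z k).im) + ofReals fun k => (z k).re := by
    intro z
    funext k
    apply Complex.ext <;> simp [p, ofReals]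
  rw [hdecomp z, hdecomp w, htrans _ (hpΩ _ hz), htrans _ (hpΩ _ hw)]
  exact hcst _ hz _ hw

theorem pairing_add_ofReals {n : ℕ} (z : Fin n → ℂ) (t μ : Fin n → ℝ) :
    pairing (z + ofReals t) μ = pairing z μ + ((t ⬝ᵥ μ : ℝ) : ℂ) := by
  simp only [pairing, Pi.add_apply, ofReals, add_mul, Finset.sum_add_distrib, dotProduct]
  push_cast
  rfl

theorem exp_pairing_add_ofReals {n : ℕ} (z : Fin n → ℂ) (t μ : Fin n → ℝ) :
    Complex.exp (Complex.I * pairing (z + ofReals t) μ) =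
      phase t μ * Complex.exp (Complex.I * pairing z μ) := by
  rw [pairing_add_ofReals, coe_phase, ← Complex.exp_add]
  congr 1
  ring

theorem pairing_neg {n : ℕ} (z : Fin n → ℂ) (μ : Fin n → ℝ) :
    pairing z (-μ) = -pairing z μ := by
  simp [pairing, Finset.sum_neg_distrib]

theorem differentiable_exp_pairing {n : ℕ} (μ : Fin n → ℝ) :
    Differentiable ℂ fun z : Fin n → ℂ => Complex.exp (Complex.I * pairing z μ) := by
  simp only [pairing]
  fun_prop

theorem norm_exp_pairing {n : ℕ} (z : Fin n → ℂ) (μ : Fin n → ℝ) :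
    ‖Complex.exp (Complex.I * pairing z μ)‖ = Real.exp (-((fun k => (z k).im) ⬝ᵥ μ)) := by
  rw [Complex.norm_exp]
  congr 1
  simp [pairing, dotProduct]

theorem exists_bound_exp_pairing {n : ℕ} {C : Set (Fin n → ℝ)} (hC : IsCompact C)
    (μ : Fin n → ℝ) :
    ∃ B : ℝ, 0 ≤ B ∧ ∀ z ∈ tube C, ‖Complex.exp (Complex.I * pairing z μ)‖ ≤ B := by
  obtain ⟨B, hB⟩ := hC.exists_bound_of_continuousOn
    (f := fun y : Fin n → ℝ => Real.exp (-(y ⬝ᵥ μ)))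
    (Continuous.continuousOn (by simp only [dotProduct]; fun_prop))
  refine ⟨max B 0, le_max_right _ _, fun z hz => ?_⟩
  rw [norm_exp_pairing]
  exact (le_abs_self _).trans ((hB _ hz).trans (le_max_left _ _))

/-- The Bohr coefficient with respect to an invariant mean: it exists, and it does not depend on
the horizontal slice. -/
theorem IsHolomorphicAP.exists_coeff {n : ℕ} {Ω : Set (Fin n → ℝ)} (hΩo : IsOpen Ω)
    (hΩc : Convex ℝ Ω) {f : tube Ω → ℂ} (hf : IsHolomorphicAP f) {U : Ultrafilter ℝ}
    (hU : (U : Filter ℝ) ≤ atTop) (μ : Fin n → ℝ) :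
    ∃ a : ℂ, ∀ z : tube Ω, HasMean U (fun t => f (shift t z) * (phase t (-μ) : ℂ))
      (a * Complex.exp (Complex.I * pairing z.1 μ)) := by
  obtain ⟨g, hg, hgf⟩ := hf.holomorphic
  set e : (Fin n → ℂ) → ℂ := fun w => Complex.exp (Complex.I * pairing w (-μ)) with he
  set G : (Fin n → ℂ) → ℂ := fun w => g w * e w with hGdef
  have hG : DifferentiableOn ℂ G (tube Ω) :=
    hg.mul (differentiable_exp_pairing (-μ)).differentiableOn
  have hB : ∀ C : Set (Fin n → ℝ), IsCompact C → C ⊆ Ω → ∃ B, ∀ w ∈ tube C, ‖G w‖ ≤ B := by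
    intro C hC hCΩ
    obtain ⟨B, hB0, hB⟩ := hf.bounded hC hCΩ
    obtain ⟨B', hB0', hB'⟩ := exists_bound_exp_pairing hC (-μ)
    refine ⟨B * B', fun w hw => ?_⟩
    rw [hGdef, norm_mul]
    refine mul_le_mul ?_ (hB' w hw) (norm_nonneg _) hB0
    have h1 := hgf ⟨w, hCΩ hw⟩
    simp only at h1
    rw [h1]
    exact hB _ hw
  have hex : ∀ z ∈ tube Ω, ∃ a, HasMean U (fun t => G (z + ofReals t)) a := by
    intro z hz
    obtain ⟨B, hB'⟩ := hB {fun k => (z k).im} isCompact_singleton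
      (Set.singleton_subset_iff.2 hz)
    exact HasMean.exists_of_bounded hU fun t =>
      hB' _ (add_ofReals_mem_tube (Ω := {fun k => (z k).im}) rfl t)
  choose! H hH using hex
  have hcst := fun (z w : tube Ω) => mean_eq_of_mem_tube hΩo hΩc hG hB hU hH z.2 w.2
  obtain ⟨a, ha⟩ : ∃ a, ∀ z : tube Ω, H z.1 = a := by
    by_cases hne : Nonempty (tube Ω)
    · obtain ⟨w⟩ := hne
      exact ⟨H w.1, fun z => hcst z w⟩
    · exact ⟨0, fun z => (hne ⟨z⟩).elim⟩
  refine ⟨a, fun z => ?_⟩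
  have h1 := (hH z.1 z.2).const_mul (Complex.exp (Complex.I * pairing z.1 μ))
  rw [ha, mul_comm _ a] at h1
  convert h1 using 2 with t
  have h2 : Complex.exp (Complex.I * pairing z.1 μ) * e z.1 = 1 := by
    simp only [he]
    rw [pairing_neg, ← Complex.exp_add, ← mul_add, add_neg_cancel, mul_zero, Complex.exp_zero]
  have h3 : e (z.1 + ofReals t) = phase t (-μ) * e z.1 := exp_pairing_add_ofReals _ _ _
  rw [← hgf, coe_shift, hGdef]
  simp only
  rw [h3]
  linear_combination (-(g (z.1 + ofReals t) * phase t (-μ))) * h2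

/-! ### Approximation by exponential sums and Bohr coefficients -/

/-- The coefficients `c(μ)` multiplied by `a(μ)`. -/
def modulate {V : Type*} (a : V → ℂ) (c : V →₀ ℂ) : V →₀ ℂ :=
  Finsupp.linearCombination ℂ (fun μ => Finsupp.single μ (a μ)) c

theorem modulate_sub {V : Type*} (a : V → ℂ) (c d : V →₀ ℂ) :
    modulate a (c - d) = modulate a c - modulate a d := map_sub _ _ _

theorem modulate_apply {V : Type*} (a : V → ℂ) (c : V →₀ ℂ) (μ : V) :
    modulate a c μ = c μ * a μ := by
  classical
  induction c using Finsupp.induction_linear with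
  | zero => simp [modulate]
  | add c d hc hd =>
    have : modulate a (c + d) = modulate a c + modulate a d := map_add _ _ _
    rw [this, Finsupp.add_apply, hc, hd, Finsupp.add_apply, add_mul]
  | single ν x =>
    rw [modulate, Finsupp.linearCombination_single, Finsupp.smul_apply, Finsupp.single_apply,
      Finsupp.single_apply]
    split_ifs with h
    · rw [h, smul_eq_mul]
    · simp

theorem expSum_eq_sum_of_subset {n : ℕ} {c : (Fin n → ℝ) →₀ ℂ} {S : Finset (Fin n → ℝ)}
    (h : ∀ μ ∉ S, c μ = 0) (z : Fin n → ℂ) :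
    expSum c z = ∑ μ ∈ S, c μ * Complex.exp (Complex.I * pairing z μ) := by
  rw [expSum_eq_sum]
  refine Finset.sum_subset (fun μ hμ => ?_) fun μ _ hμ => ?_
  · by_contra hS
    exact (Finsupp.mem_support_iff.1 hμ) (h μ hS)
  · rw [Finsupp.notMem_support_iff.1 hμ, zero_mul]

theorem expSum_modulate {n : ℕ} (a : (Fin n → ℝ) → ℂ) (c : (Fin n → ℝ) →₀ ℂ) (z : Fin n → ℂ) :
    expSum (modulate a c) z =
      ∑ μ ∈ c.support, c μ * (a μ * Complex.exp (Complex.I * pairing z μ)) := by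
  rw [expSum_eq_sum_of_subset (S := c.support)]
  · refine Finset.sum_congr rfl fun μ _ => ?_
    rw [modulate_apply, mul_assoc]
  · intro μ hμ
    rw [modulate_apply, Finsupp.notMem_support_iff.1 hμ, zero_mul]

theorem expSum_add_ofReals {n : ℕ} (c : (Fin n → ℝ) →₀ ℂ) (z : Fin n → ℂ) (t : Fin n → ℝ) :
    expSum c (z + ofReals t) = expSum (modulate (fun μ => (phase t μ : ℂ)) c) z := by
  rw [expSum_modulate, expSum_eq_sum]
  exact Finset.sum_congr rfl fun μ _ => by rw [exp_pairing_add_ofReals]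

theorem differentiable_expSum {n : ℕ} (c : (Fin n → ℝ) →₀ ℂ) :
    Differentiable ℂ (expSum c) := by
  have : expSum c = fun z => ∑ μ ∈ c.support, c μ * Complex.exp (Complex.I * pairing z μ) :=
    funext fun z => expSum_eq_sum c z
  rw [this]
  exact Differentiable.fun_sum fun μ _ => (differentiable_exp_pairing μ).const_mul _

theorem continuous_expSum_add_ofReals {n : ℕ} (c : (Fin n → ℝ) →₀ ℂ) (z : Fin n → ℂ) :
    Continuous fun t => expSum c (z + ofReals t) :=
  (differentiable_expSum c).continuous.comp (continuous_const.add continuous_ofReals)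

/-- Exponential sums with frequencies in a fixed finite set converge to zero uniformly on subtubes
when their coefficients do. -/
theorem eventually_norm_expSum_le {n : ℕ} {ι : Type*} {l : Filter ι}
    {c : ι → (Fin n → ℝ) →₀ ℂ} {S : Finset (Fin n → ℝ)} (hS : ∀ i, ∀ μ ∉ S, c i μ = 0)
    (hc : ∀ μ ∈ S, Tendsto (fun i => c i μ) l (𝓝 0)) {C : Set (Fin n → ℝ)} (hC : IsCompact C)
    {ε : ℝ} (hε : 0 < ε) : ∀ᶠ i in l, ∀ z ∈ tube C, ‖expSum (c i) z‖ ≤ ε := by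
  choose B hB0 hB using exists_bound_exp_pairing hC
  have h1 : Tendsto (fun i => ∑ μ ∈ S, ‖c i μ‖ * B μ) l (𝓝 (∑ μ ∈ S, ‖(0 : ℂ)‖ * B μ)) :=
    tendsto_finsetSum _ fun μ hμ => (hc μ hμ).norm.mul_const _
  simp only [norm_zero, zero_mul, Finset.sum_const_zero] at h1
  filter_upwards [h1.eventually (gt_mem_nhds hε)] with i hi z hz
  rw [expSum_eq_sum_of_subset (hS i)]
  refine (norm_sum_le _ _).trans (le_trans (Finset.sum_le_sum fun μ _ => ?_) hi.le)
  rw [norm_mul]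
  exact mul_le_mul_of_nonneg_left (hB μ z hz) (norm_nonneg _)

/-- Multiplying the coefficients of an exponential sum by a character does not increase its
supremum on a subtube: by Kronecker's theorem the result is a pointwise limit of translates. -/
theorem norm_expSum_modulate_le {n : ℕ} (χ : AddChar (Fin n → ℝ) Circle)
    {c : (Fin n → ℝ) →₀ ℂ} {C : Set (Fin n → ℝ)} {B : ℝ}
    (hB : ∀ z ∈ tube C, ‖expSum c z‖ ≤ B) {z : Fin n → ℂ} (hz : z ∈ tube C) :
    ‖expSum (modulate (fun μ => (χ μ : ℂ)) c) z‖ ≤ B := by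
  obtain ⟨V, hV, hχ⟩ := exists_filter_tendsto_phase χ
  have h1 : Tendsto (fun t => expSum c (z + ofReals t)) V
      (𝓝 (expSum (modulate (fun μ => (χ μ : ℂ)) c) z)) := by
    simp only [expSum_add_ofReals, expSum_modulate]
    refine tendsto_finsetSum _ fun μ _ => Tendsto.const_mul _ (Tendsto.mul_const _ ?_)
    exact (continuous_subtype_val.tendsto (χ μ)).comp (hχ μ)
  exact le_of_tendsto h1.norm
    (Eventually.of_forall fun t => hB _ (add_ofReals_mem_tube hz t))

/-- The orthogonality relations for an exponential sum. -/
theorem hasMean_expSum {n : ℕ} {l : Filter ℝ} (hl : l ≤ atTop) (c : (Fin n → ℝ) →₀ ℂ)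
    (z : Fin n → ℂ) (μ : Fin n → ℝ) :
    HasMean l (fun t => expSum c (z + ofReals t) * (phase t (-μ) : ℂ))
      (c μ * Complex.exp (Complex.I * pairing z μ)) := by
  classical
  have h1 := HasMean.sum (l := l) c.support
    (φ := fun ν t => (c ν * Complex.exp (Complex.I * pairing z ν)) * (phase t (ν - μ) : ℂ))
    (fun ν _ => continuous_const.mul (continuous_phase _))
    (fun ν _ => (hasMean_phase hl (ν - μ)).const_mul _)
  have h2 : ∑ ν ∈ c.support, c ν * Complex.exp (Complex.I * pairing z ν) *
      (if ν - μ = 0 then 1 else 0) = c μ * Complex.exp (Complex.I * pairing z μ) := by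
    rw [Finset.sum_eq_single μ]
    · simp
    · intro ν _ hν
      rw [if_neg (sub_ne_zero.2 hν), mul_zero]
    · intro h
      simp [Finsupp.notMem_support_iff.1 h]
  rw [h2] at h1
  convert h1 using 2 with t
  rw [expSum_eq_sum, Finset.sum_mul]
  refine Finset.sum_congr rfl fun ν _ => ?_
  rw [exp_pairing_add_ofReals, sub_eq_add_neg, AddChar.map_add_eq_mul, Circle.coe_mul]
  ring

section Coefficients

variable {n : ℕ} {Ω : Set (Fin n → ℝ)}

/-- `a(μ)` is the Bohr coefficient of `h` at `μ` with respect to the mean along `l`, for every `μ`,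
in terms of the real translates of an arbitrary point of the tube. -/
def HasCoeffs (l : Filter ℝ) (h : tube Ω → ℂ) (a : (Fin n → ℝ) → ℂ) : Prop :=
  ∀ μ z, HasMean l (fun t => h (shift t z) * (phase t (-μ) : ℂ))
    (a μ * Complex.exp (Complex.I * pairing z.1 μ))

theorem hasCoeffs_expSum {l : Filter ℝ} (hl : l ≤ atTop) (c : (Fin n → ℝ) →₀ ℂ) :
    HasCoeffs (Ω := Ω) l (fun z => expSum c z.1) c :=
  fun μ z => hasMean_expSum hl c z.1 μ

theorem HasCoeffs.sub {l : Filter ℝ} {h k : tube Ω → ℂ} {a b : (Fin n → ℝ) → ℂ}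
    (hh : ∀ z, Continuous fun t => h (shift t z)) (hk : ∀ z, Continuous fun t => k (shift t z))
    (ha : HasCoeffs l h a) (hb : HasCoeffs l k b) : HasCoeffs l (h - k) (a - b) := by
  intro μ z
  have h1 := HasMean.sub ((hh z).mul (continuous_phase (-μ))) ((hk z).mul (continuous_phase (-μ)))
    (ha μ z) (hb μ z)
  rw [← sub_mul] at h1
  change HasMean l _ ((a μ - b μ) * _)
  convert h1 using 2 with t
  simp only [Pi.sub_apply, Pi.mul_apply]
  ring

theorem HasCoeffs.norm_le {l : Filter ℝ} [NeBot l] (hl : l ≤ atTop) {h : tube Ω → ℂ}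
    {a : (Fin n → ℝ) → ℂ} (ha : HasCoeffs l h a) {z : tube Ω} {B : ℝ}
    (hB : ∀ t, ‖h (shift t z)‖ ≤ B) (μ : Fin n → ℝ) :
    ‖a μ * Complex.exp (Complex.I * pairing z.1 μ)‖ ≤ B := by
  refine (ha μ z).norm_le_const hl fun t => ?_
  rw [norm_mul, Circle.norm_coe, mul_one]
  exact hB t

/-- Averaging the translates of `h` against a trigonometric polynomial. -/
theorem HasCoeffs.hasMean_mul_charSum {l : Filter ℝ} {h : tube Ω → ℂ} {a : (Fin n → ℝ) → ℂ}
    (hh : ∀ z, Continuous fun t => h (shift t z)) (ha : HasCoeffs l h a)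
    (c : (Fin n → ℝ) →₀ ℂ) (z : tube Ω) :
    HasMean l (fun t => h (shift t z) * charSum c (twist 1 t)) (expSum (modulate a c) z.1) := by
  have h1 := HasMean.sum (l := l) c.support
    (φ := fun μ t => c μ * (h (shift t z) * (phase t (-μ) : ℂ)))
    (fun μ _ => continuous_const.mul ((hh z).mul (continuous_phase _)))
    (fun μ _ => (ha μ z).const_mul (c μ))
  rw [← expSum_modulate] at h1
  convert h1 using 2 with t
  rw [charSum_eq_sum, Finset.mul_sum]
  refine Finset.sum_congr rfl fun μ _ => ?_
  rw [twist_apply, AddChar.one_apply, Circle.coe_one]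
  ring

/-- Averaging against a positive kernel does not increase the supremum. -/
theorem HasCoeffs.norm_expSum_modulate_le {l : Filter ℝ} [NeBot l] (hl : l ≤ atTop)
    {h : tube Ω → ℂ} {a : (Fin n → ℝ) → ℂ} (hh : ∀ z, Continuous fun t => h (shift t z))
    (ha : HasCoeffs l h a) {c : (Fin n → ℝ) →₀ ℂ} (hc : IsPositiveKernel c) {z : tube Ω} {B : ℝ}
    (hB : ∀ t, ‖h (shift t z)‖ ≤ B) : ‖expSum (modulate a c) z.1‖ ≤ B := by
  have hB0 : 0 ≤ B := (norm_nonneg _).trans (hB 0)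
  have h1 := ha.hasMean_mul_charSum hh c z
  have h2 := (hc.hasMean_norm hl 1).const_mul (B : ℂ)
  have h3 := h1.norm_le (k := fun t => B * ‖charSum c (twist 1 t)‖) (b := (B : ℂ) * 1)
    (continuous_const.mul (continuous_charSum_twist 1 c).norm)
    (fun t => by
      rw [norm_mul]
      exact mul_le_mul_of_nonneg_right (hB t) (norm_nonneg _))
    (by simpa only [Complex.ofReal_mul] using h2)
  rwa [mul_one, Complex.norm_real, Real.norm_eq_abs, abs_of_nonneg hB0] at h3

/-- **Approximation theorem**: on every subtube, `f` is a uniform limit of exponential sums with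
frequencies in its spectrum. Averaging the translates of `f` against a positive kernel that is
concentrated on the Bohr neighbourhood formed by `ε`-almost periods changes `f` only a little. -/
theorem IsHolomorphicAP.exists_expSum_near {f : tube Ω → ℂ} (hf : IsHolomorphicAP f)
    {l : Filter ℝ} [NeBot l] (hl : l ≤ atTop) {a : (Fin n → ℝ) → ℂ} (ha : HasCoeffs l f a)
    {C : Set (Fin n → ℝ)} (hC : IsCompact C) (hCΩ : C ⊆ Ω) {ε : ℝ} (hε : 0 < ε) :
    ∃ c : (Fin n → ℝ) →₀ ℂ, (∀ μ, a μ = 0 → c μ = 0) ∧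
      ∀ z ∈ subtube Ω C, ‖f z - expSum c z.1‖ ≤ ε := by
  obtain ⟨B, hB0, hB⟩ := hf.bounded hC hCΩ
  obtain ⟨Λ, δ, hδ, hΛ⟩ := hf.exists_bohr_set hC hCΩ (half_pos hε)
  set η : ℝ := ε / 2 / ((2 * B / δ ^ 2) * Λ.card + 1) with hη
  have hA : 0 ≤ 2 * B / δ ^ 2 := by positivity
  have hη0 : 0 < η := by positivity
  obtain ⟨w, hw, hwΛ⟩ := exists_isPositiveKernel Λ hη0
  refine ⟨modulate a w, fun μ hμ => by rw [modulate_apply, hμ, mul_zero], fun z hz => ?_⟩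
  have hκ := continuous_charSum_twist 1 w
  have h1 := ha.hasMean_mul_charSum hf.continuous_shift w z
  have h2 : HasMean l (fun t => f z * charSum w (twist 1 t)) (f z * 1) := by
    refine HasMean.const_mul (f z) ?_
    have := hw.hasMean_norm hl 1
    simpa only [← hw.pos] using this
  have h3 := h2.sub (continuous_const.mul hκ) ((hf.continuous_shift z).mul hκ) h1
  rw [mul_one] at h3
  -- the pointwise bound: `ε / 2` on the Bohr set, and a multiple of the distance to it elsewhere
  have hpt : ∀ t, ‖f z - f (shift t z)‖ ≤
      ε / 2 + 2 * B / δ ^ 2 * ∑ μ ∈ Λ, ‖(twist 1 t μ : ℂ) - 1‖ ^ 2 := by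
    intro t
    have hs : 0 ≤ ∑ μ ∈ Λ, ‖(twist 1 t μ : ℂ) - 1‖ ^ 2 :=
      Finset.sum_nonneg fun μ _ => by positivity
    by_cases hb : ∀ μ ∈ Λ, ‖(phase t μ : ℂ) - 1‖ < δ
    · have h4 := hΛ t hb z hz
      rw [norm_sub_rev] at h4
      have := mul_nonneg hA hs
      linarith
    · push Not at hb
      obtain ⟨μ, hμ, hd⟩ := hb
      have h4 : ‖f z - f (shift t z)‖ ≤ 2 * B := by
        refine (norm_sub_le _ _).trans ?_
        linarith [hB z hz, hB _ (shift_mem_subtube t hz)]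
      have h5 : ‖(twist 1 t μ : ℂ) - 1‖ ^ 2 ≤ ∑ μ ∈ Λ, ‖(twist 1 t μ : ℂ) - 1‖ ^ 2 :=
        Finset.single_le_sum (f := fun μ => ‖(twist 1 t μ : ℂ) - 1‖ ^ 2)
          (fun μ _ => by positivity) hμ
      have h6 : δ ^ 2 ≤ ‖(twist 1 t μ : ℂ) - 1‖ ^ 2 := by
        rw [norm_twist_sub_one, AddChar.one_apply, Circle.coe_one]
        gcongr
      have h7 : 2 * B ≤ 2 * B / δ ^ 2 * ∑ μ ∈ Λ, ‖(twist 1 t μ : ℂ) - 1‖ ^ 2 := by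
        calc 2 * B = 2 * B / δ ^ 2 * δ ^ 2 := by field_simp
          _ ≤ _ := mul_le_mul_of_nonneg_left (h6.trans h5) hA
      linarith
  have hct : ∀ μ : Fin n → ℝ, Continuous fun t => ‖(twist 1 t μ : ℂ) - 1‖ ^ 2 := fun μ =>
    ((continuous_twist 1 μ).sub continuous_const).norm.pow 2
  have h4 : HasMean l (fun t => (((ε / 2) * ‖charSum w (twist 1 t)‖ + 2 * B / δ ^ 2 *
      ∑ μ ∈ Λ, ‖charSum w (twist 1 t)‖ * ‖(twist 1 t μ : ℂ) - 1‖ ^ 2 : ℝ) : ℂ))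
      (((ε / 2 : ℝ) : ℂ) * 1 + ((2 * B / δ ^ 2 : ℝ) : ℂ) * ∑ μ ∈ Λ, (2 - w μ - w (-μ))) := by
    have h5 := (hw.hasMean_norm hl 1).const_mul ((ε / 2 : ℝ) : ℂ)
    have h6 := (HasMean.sum (l := l) Λ
      (φ := fun μ t => ((‖charSum w (twist 1 t)‖ * ‖(twist 1 t μ : ℂ) - 1‖ ^ 2 : ℝ) : ℂ))
      (fun μ _ => Complex.continuous_ofReal.comp (hκ.norm.mul (hct μ)))
      (fun μ _ => hw.hasMean_norm_mul_sq hl 1 μ)).const_mul ((2 * B / δ ^ 2 : ℝ) : ℂ)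
    have h7 := h5.add (continuous_const.mul (Complex.continuous_ofReal.comp hκ.norm))
      (continuous_const.mul (continuous_finsetSum _ fun μ _ =>
        Complex.continuous_ofReal.comp (hκ.norm.mul (hct μ)))) h6
    convert h7 using 2 with t
    simp only [Complex.ofReal_add, Complex.ofReal_mul, Complex.ofReal_sum, Pi.mul_apply,
      Function.comp_apply]
  have h5 := h3.norm_le
    (k := fun t => (ε / 2) * ‖charSum w (twist 1 t)‖ + 2 * B / δ ^ 2 *
      ∑ μ ∈ Λ, ‖charSum w (twist 1 t)‖ * ‖(twist 1 t μ : ℂ) - 1‖ ^ 2)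
    ((continuous_const.mul hκ.norm).add
      (continuous_const.mul (continuous_finsetSum _ fun μ _ => hκ.norm.mul (hct μ))))
    (fun t => by
      have h8 : f z * charSum w (twist 1 t) - f (shift t z) * charSum w (twist 1 t) =
        (f z - f (shift t z)) * charSum w (twist 1 t) := by ring
      simp only [Pi.mul_apply]
      rw [h8, norm_mul]
      refine (mul_le_mul_of_nonneg_right (hpt t) (norm_nonneg _)).trans_eq ?_
      rw [← Finset.mul_sum]
      ring) h4
  refine h5.trans ?_
  refine (norm_add_le _ _).trans ?_
  rw [mul_one, norm_mul, Complex.norm_real, Complex.norm_real, Real.norm_eq_abs, Real.norm_eq_abs,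
    abs_of_pos (half_pos hε), abs_of_nonneg hA]
  have h6 : ‖∑ μ ∈ Λ, (2 - w μ - w (-μ))‖ ≤ Λ.card * η := by
    refine (norm_sum_le _ _).trans ?_
    rw [← nsmul_eq_mul]
    exact Finset.sum_le_card_nsmul _ _ _ hwΛ
  have h7 : 2 * B / δ ^ 2 * ‖∑ μ ∈ Λ, (2 - w μ - w (-μ))‖ ≤ ε / 2 := by
    calc _ ≤ 2 * B / δ ^ 2 * (Λ.card * η) := mul_le_mul_of_nonneg_left h6 hA
      _ = (2 * B / δ ^ 2 * Λ.card) * η := by ring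
      _ ≤ ((2 * B / δ ^ 2) * Λ.card + 1) * η := by
        refine mul_le_mul_of_nonneg_right ?_ hη0.le
        linarith
      _ = ε / 2 := by
        rw [hη]
        field_simp
  linarith

/-- The Bohr coefficients of a holomorphic almost periodic function exist as honest limits. -/
theorem IsHolomorphicAP.exists_hasCoeffs (hΩo : IsOpen Ω) (hΩc : Convex ℝ Ω) {f : tube Ω → ℂ}
    (hf : IsHolomorphicAP f) : ∃ a, HasCoeffs atTop f a := by
  have hex : ∀ U : Ultrafilter ℝ, (U : Filter ℝ) ≤ atTop → ∃ a, HasCoeffs U f a := by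
    intro U hU
    choose a ha using hf.exists_coeff hΩo hΩc hU
    exact ⟨a, ha⟩
  have hU₀ : (Ultrafilter.of (atTop : Filter ℝ) : Filter ℝ) ≤ atTop := Ultrafilter.of_le _
  obtain ⟨a, ha⟩ := hex (Ultrafilter.of atTop) hU₀
  refine ⟨a, fun μ z => (tendsto_iff_ultrafilter _ _ _).2 fun U hU => ?_⟩
  obtain ⟨b, hb⟩ := hex U hU
  have hC : ({fun k => (z.1 k).im} : Set (Fin n → ℝ)) ⊆ Ω := Set.singleton_subset_iff.2 z.2
  -- both coefficients are close to that of an approximating exponential sum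
  have hab : ∀ ε : ℝ, 0 < ε → ‖b μ * Complex.exp (Complex.I * pairing z.1 μ) -
      a μ * Complex.exp (Complex.I * pairing z.1 μ)‖ ≤ ε := by
    intro ε hε
    obtain ⟨c, -, hc⟩ := hf.exists_expSum_near hU₀ ha isCompact_singleton hC
      (half_pos hε)
    have hcs : ∀ w : tube Ω, Continuous fun t => expSum c (shift t w).1 := fun w =>
      continuous_expSum_add_ofReals c w.1
    have hbd : ∀ t, ‖(f - fun z : tube Ω => expSum c z.1) (shift t z)‖ ≤ ε / 2 := fun t =>
      hc _ (shift_mem_subtube t rfl)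
    have h1 := (HasCoeffs.sub hf.continuous_shift hcs hb (hasCoeffs_expSum hU c)).norm_le hU hbd μ
    have h2 := (HasCoeffs.sub hf.continuous_shift hcs ha
      (hasCoeffs_expSum hU₀ c)).norm_le hU₀ hbd μ
    simp only [Pi.sub_apply] at h1 h2
    calc _ = ‖(b μ - c μ) * Complex.exp (Complex.I * pairing z.1 μ) -
        (a μ - c μ) * Complex.exp (Complex.I * pairing z.1 μ)‖ := by congr 1; ring
      _ ≤ ε / 2 + ε / 2 := (norm_sub_le _ _).trans (add_le_add h1 h2)
      _ = ε := by ring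
  have h0 := le_of_forall_pos_le_add (a := ‖b μ * Complex.exp (Complex.I * pairing z.1 μ) -
      a μ * Complex.exp (Complex.I * pairing z.1 μ)‖) (b := 0) fun ε hε => by
    rw [zero_add]; exact hab ε hε
  have h1 := sub_eq_zero.1 (norm_le_zero_iff.1 h0)
  rw [← h1]
  exact hb μ z

theorem tubePoint_eq_shift (x : Fin n → ℝ) (y : Ω) :
    tubePoint x y = shift x (tubePoint 0 y) := by
  apply Subtype.ext
  funext k
  simp only [tubePoint, shift, Pi.zero_apply]
  push_cast
  ring

theorem HasCoeffs.hasBohrCoeff {f : tube Ω → ℂ} {a : (Fin n → ℝ) → ℂ}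
    (ha : HasCoeffs atTop f a) (μ : Fin n → ℝ) : HasBohrCoeff f μ (a μ) := by
  intro y
  have h1 := (ha μ (tubePoint 0 y)).const_mul
    (Complex.exp (Complex.I * pairing (tubePoint 0 y).1 (-μ)))
  have h2 : Complex.exp (Complex.I * pairing (tubePoint 0 y).1 (-μ)) *
      (a μ * Complex.exp (Complex.I * pairing (tubePoint 0 y).1 μ)) = a μ := by
    rw [pairing_neg, mul_left_comm, ← Complex.exp_add]
    simp
  rw [h2] at h1
  refine Tendsto.congr (fun s => ?_) h1
  rw [boxAvg, bohrMean]
  congr 2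
  funext x
  rw [tubePoint_eq_shift x y, ← mul_neg, ← pairing_neg, coe_shift, exp_pairing_add_ofReals]
  ring

theorem bohr_eq_of_hasBohrCoeff (hΩ : Ω.Nonempty) {f : tube Ω → ℂ} {μ : Fin n → ℝ} {c : ℂ}
    (h : HasBohrCoeff f μ c) : bohr f μ = c := by
  have hex : ∃ c, HasBohrCoeff f μ c := ⟨c, h⟩
  obtain ⟨y, hy⟩ := hΩ
  rw [bohr, dif_pos hex]
  exact tendsto_nhds_unique (hex.choose_spec ⟨y, hy⟩) (h ⟨y, hy⟩)

theorem IsHolomorphicAP.hasCoeffs_bohr (hΩ : Ω.Nonempty) (hΩo : IsOpen Ω) (hΩc : Convex ℝ Ω)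
    {f : tube Ω → ℂ} (hf : IsHolomorphicAP f) : HasCoeffs atTop f (bohr f) := by
  obtain ⟨a, ha⟩ := hf.exists_hasCoeffs hΩo hΩc
  have h1 : bohr f = a := funext fun μ => bohr_eq_of_hasBohrCoeff hΩ (ha.hasBohrCoeff μ)
  rwa [h1]

theorem bohr_expSum (hΩ : Ω.Nonempty) (c : (Fin n → ℝ) →₀ ℂ) :
    bohr (fun z : tube Ω => expSum c z.1) = c :=
  funext fun μ => bohr_eq_of_hasBohrCoeff hΩ ((hasCoeffs_expSum le_rfl c).hasBohrCoeff μ)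

theorem IsHolomorphicAP.countable_bohrSpectrum (hΩ : Ω.Nonempty) (hΩo : IsOpen Ω)
    (hΩc : Convex ℝ Ω) {f : tube Ω → ℂ} (hf : IsHolomorphicAP f) :
    (bohrSpectrum f).Countable := by
  have ha := hf.hasCoeffs_bohr hΩ hΩo hΩc
  obtain ⟨y, hy⟩ := hΩ
  choose c _ hc using fun k : ℕ => hf.exists_expSum_near le_rfl ha isCompact_singleton
    (Set.singleton_subset_iff.2 hy) (Nat.one_div_pos_of_nat (α := ℝ) (n := k))
  refine (Set.countable_iUnion fun k => (c k).support.countable_toSet).mono fun μ hμ => ?_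
  by_contra hcon
  simp only [Set.mem_iUnion, Finset.mem_coe, Finsupp.mem_support_iff, not_exists, not_not] at hcon
  have hz : tubePoint 0 ⟨y, hy⟩ ∈ subtube Ω {y} := by
    rw [mem_subtube_iff, Set.mem_singleton_iff]
    funext k
    simp [tubePoint]
  have h1 : ∀ k : ℕ, ‖bohr f μ *
      Complex.exp (Complex.I * pairing (tubePoint 0 ⟨y, hy⟩ : tube Ω).1 μ)‖ ≤ 1 / ((k : ℝ) + 1) := by
    intro k
    have h2 := (HasCoeffs.sub hf.continuous_shift
      (fun w => continuous_expSum_add_ofReals (c k) w.1) ha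
      (hasCoeffs_expSum le_rfl (c k))).norm_le le_rfl
      (fun t => hc k _ (shift_mem_subtube t hz)) μ
    rwa [Pi.sub_apply, hcon k, sub_zero] at h2
  have h2 := ge_of_tendsto' (tendsto_one_div_add_atTop_nhds_zero_nat (𝕜 := ℝ)) h1
  rw [norm_le_zero_iff, mul_eq_zero, or_iff_left (Complex.exp_ne_zero _)] at h2
  exact hμ h2

theorem fejerSum_eq_expSum {I : Set ℕ} (ω : I → (Fin n → ℝ)) (j : ℕ) (f : tube Ω → ℂ) :
    fejerSum ω j f = fun z => expSum (modulate (bohr f) (fejerCoeff ω j)) z.1 := by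
  funext z
  rw [modulate, fejerCoeff, map_sum, expSum, map_sum, fejerSum]
  refine Finset.sum_congr rfl fun ν _ => ?_
  rw [Finsupp.linearCombination_single, Finsupp.smul_single, Finsupp.linearCombination_single]
  rfl

/-- The Bochner-Fejér sums of `f` come close to every exponential sum that is close to `f` and has
its frequencies in the rational span of the basis. -/
theorem IsHolomorphicAP.eventually_fejer_near (hΩ : Ω.Nonempty) (hΩo : IsOpen Ω)
    (hΩc : Convex ℝ Ω) {f : tube Ω → ℂ} (hf : IsHolomorphicAP f) {I : Set ℕ}
    {ω : I → (Fin n → ℝ)} (hω : LinearIndependent ℚ ω) {C : Set (Fin n → ℝ)} (hC : IsCompact C)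
    (hCΩ : C ⊆ Ω) {ε : ℝ} (hε : 0 < ε) {p : (Fin n → ℝ) →₀ ℂ}
    (hp : ∀ μ, p μ ≠ 0 → μ ∈ Submodule.span ℚ (Set.range ω))
    (hfp : ∀ z ∈ subtube Ω C, ‖f z - expSum p z.1‖ ≤ ε) :
    ∀ᶠ j in atTop, ∀ z ∈ tube C,
      ‖expSum (modulate (bohr f) (fejerCoeff ω j) - p) z‖ ≤ 2 * ε := by
  have ha := hf.hasCoeffs_bohr hΩ hΩo hΩc
  -- the kernel is applied to `f - expSum p`, where it contracts, and to `expSum p`, where its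
  -- coefficients tend to `1`
  have h1 : ∀ j, ∀ z ∈ tube C,
      ‖expSum (modulate (bohr f - ⇑p) (fejerCoeff ω j)) z‖ ≤ ε := by
    intro j z hz
    have hcs : ∀ w : tube Ω, Continuous fun t => expSum p (shift t w).1 := fun w =>
      continuous_expSum_add_ofReals p w.1
    exact (HasCoeffs.sub hf.continuous_shift hcs ha
      (hasCoeffs_expSum le_rfl p)).norm_expSum_modulate_le (z := ⟨z, hCΩ hz⟩) le_rfl
      (fun w => (hf.continuous_shift w).sub (hcs w)) (isPositiveKernel_fejerCoeff hω j)
      fun t => hfp _ (shift_mem_subtube (Ω' := C) t hz)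
  have h2 : ∀ᶠ j in atTop, ∀ z ∈ tube C,
      ‖expSum (modulate p (fejerCoeff ω j) - p) z‖ ≤ ε := by
    refine eventually_norm_expSum_le (S := p.support) (fun j μ hμ => ?_) (fun μ hμ => ?_) hC hε
    · rw [Finsupp.sub_apply, modulate_apply, Finsupp.notMem_support_iff.1 hμ, mul_zero, sub_zero]
    · simp only [Finsupp.sub_apply, modulate_apply]
      have h3 := ((tendsto_fejerCoeff hω (hp μ (Finsupp.mem_support_iff.1 hμ))).mul_const
        (p μ)).sub_const (p μ)
      simpa using h3
  filter_upwards [h2] with j hj z hz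
  have h3 : modulate (bohr f) (fejerCoeff ω j) - p =
      modulate (bohr f - ⇑p) (fejerCoeff ω j) - (p - modulate p (fejerCoeff ω j)) := by
    ext μ
    simp only [Finsupp.sub_apply, modulate_apply, Pi.sub_apply]
    ring
  rw [h3, expSum_sub]
  have h4 := hj z hz
  rw [expSum_sub, norm_sub_rev, ← expSum_sub] at h4
  refine (norm_sub_le _ _).trans ?_
  linarith [h1 j z hz]

end Coefficients

/-! ### Translates, limits and perturbations of mappings -/

variable {n m : ℕ} {Ω : Set (Fin n → ℝ)}

theorem CompactlyIn.of_isCompact {C : Set (Fin n → ℝ)} (hC : IsCompact C) (hCΩ : C ⊆ Ω) :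
    CompactlyIn C Ω := by
  rw [CompactlyIn, hC.isClosed.closure_eq]
  exact ⟨hC, hCΩ⟩

theorem isHolomorphicAP_component (F : HAP Ω m) (l : Fin m) :
    IsHolomorphicAP (component F.1 l) where
  holomorphic := by
    obtain ⟨g, hg, hgF⟩ := F.2.1
    exact ⟨fun z => g z l, differentiableOn_pi.1 hg l, fun z => congrFun (hgF z) l⟩
  almostPeriodic ε hε C hC hCΩ := by
    obtain ⟨t, ht, h⟩ := F.2.2 ε hε C (.of_isCompact hC hCΩ)
    refine ⟨∑ k, t k, fun ξ => ?_⟩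
    obtain ⟨τ, hτ, δ, hδ, hd⟩ := h ξ
    refine ⟨τ, fun k => (hτ k).trans_le ?_, fun z hz => (hd z hz l).trans hδ.le⟩
    exact Finset.single_le_sum (fun k _ => (ht k).le) (Finset.mem_univ k)

theorem tendsto_tubeMap_iff {ι : Type*} {V : Filter ι} {F : ι → TubeMap Ω m} {G : TubeMap Ω m} :
    Tendsto F V (𝓝 G) ↔ ∀ C : Set (Fin n → ℝ), IsCompact C → C ⊆ Ω → ∀ ε : ℝ, 0 < ε →
      ∀ᶠ i in V, ∀ z ∈ subtube Ω C, ∀ l, ‖component (F i) l z - component G l z‖ ≤ ε := by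
  rw [UniformOnFun.tendsto_iff_tendstoUniformlyOn]
  constructor
  · intro h C hC hCΩ ε hε
    have h1 := Metric.tendstoUniformlyOn_iff.1
      (h (subtube Ω C) ⟨C, .of_isCompact hC hCΩ, rfl⟩) ε hε
    filter_upwards [h1] with i hi z hz l
    have h2 := ((dist_pi_lt_iff hε).1 (hi z hz) l).le
    rw [dist_comm, dist_eq_norm] at h2
    exact h2
  · rintro h S ⟨Ω', hΩ', rfl⟩
    rw [Metric.tendstoUniformlyOn_iff]
    intro ε hε
    filter_upwards [h (closure Ω') hΩ'.1 hΩ'.2 (ε / 2) (half_pos hε)] with i hi z hz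
    rw [dist_pi_lt_iff hε]
    intro l
    rw [dist_comm, dist_eq_norm]
    exact (hi z (subset_closure hz) l).trans_lt (half_lt_self hε)

theorem t2Space_tubeMap : T2Space (TubeMap Ω m) := by
  refine UniformOnFun.t2Space_of_covering (Set.eq_univ_of_forall fun z => ?_)
  refine Set.mem_sUnion.2 ⟨subtube Ω {fun k => (z.1 k).im}, ⟨_, ?_, rfl⟩, ?_⟩
  · exact .of_isCompact isCompact_singleton (Set.singleton_subset_iff.2 z.2)
  · exact mem_subtube_iff.2 rfl

/-- A family of mappings that is eventually close to a fixed mapping, for every subtube and every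
`ε`, converges. -/
theorem exists_tendsto_tubeMap {ι : Type*} {V : Filter ι} [NeBot V] {F : ι → TubeMap Ω m}
    (h : ∀ C : Set (Fin n → ℝ), IsCompact C → C ⊆ Ω → ∀ ε : ℝ, 0 < ε →
      ∃ H : Fin m → tube Ω → ℂ, ∀ᶠ i in V, ∀ z ∈ subtube Ω C, ∀ l,
        ‖component (F i) l z - H l z‖ ≤ ε) :
    ∃ G : TubeMap Ω m, Tendsto F V (𝓝 G) := by
  have hpt : ∀ (z : tube Ω) (l : Fin m), ∃ a, Tendsto (fun i => component (F i) l z) V (𝓝 a) := by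
    intro z l
    refine cauchy_map_iff_exists_tendsto.1 (Metric.cauchy_iff.2 ⟨inferInstance, fun ε hε => ?_⟩)
    obtain ⟨H, hH⟩ := h {fun k => (z.1 k).im} isCompact_singleton
      (Set.singleton_subset_iff.2 z.2) (ε / 3) (by positivity)
    refine ⟨Metric.closedBall (H l z) (ε / 3), ?_, fun x hx y hy => ?_⟩
    · rw [mem_map]
      filter_upwards [hH] with i hi
      rw [Set.mem_preimage, mem_closedBall_iff_norm]
      exact hi z rfl l
    · have h1 := dist_triangle_right x y (H l z)
      rw [Metric.mem_closedBall] at hx hy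
      linarith
  choose g hg using hpt
  refine ⟨UniformOnFun.ofFun (subtubes Ω) g, tendsto_tubeMap_iff.2 fun C hC hCΩ ε hε => ?_⟩
  obtain ⟨H, hH⟩ := h C hC hCΩ (ε / 2) (half_pos hε)
  filter_upwards [hH] with i hi z hz l
  have h1 : ‖g z l - H l z‖ ≤ ε / 2 := by
    refine le_of_tendsto ((hg z l).sub_const (H l z)).norm ?_
    filter_upwards [hH] with j hj
    exact hj z hz l
  have h2 := norm_sub_le (component (F i) l z - H l z) (g z l - H l z)
  rw [sub_sub_sub_cancel_right] at h2
  change ‖component (F i) l z - g z l‖ ≤ ε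
  linarith [hi z hz l]

/-- Limits of holomorphic mappings are holomorphic: by the Schwarz lemma the derivatives converge
locally uniformly as well. -/
theorem isHolomorphic_of_tendsto (hΩo : IsOpen Ω) {ι : Type*} {V : Filter ι} [NeBot V]
    {F : ι → TubeMap Ω m} {G : TubeMap Ω m} (hF : ∀ i, IsHolomorphic (F i))
    (h : Tendsto F V (𝓝 G)) : IsHolomorphic G := by
  classical
  choose f hf hfF using hF
  let g : (Fin n → ℂ) → (Fin m → ℂ) := fun z =>
    if hz : z ∈ tube Ω then UniformOnFun.toFun (subtubes Ω) G ⟨z, hz⟩ else 0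
  have hg : ∀ z : tube Ω, g z.1 = UniformOnFun.toFun (subtubes Ω) G z := fun z => dif_pos z.2
  have hunif : ∀ C : Set (Fin n → ℝ), IsCompact C → C ⊆ Ω → ∀ ε : ℝ, 0 < ε →
      ∀ᶠ i in V, ∀ z ∈ tube C, ‖f i z - g z‖ ≤ ε := by
    intro C hC hCΩ ε hε
    filter_upwards [tendsto_tubeMap_iff.1 h C hC hCΩ ε hε] with i hi z hz
    rw [pi_norm_le_iff_of_nonneg hε.le]
    intro l
    have h1 := hi ⟨z, hCΩ hz⟩ hz l
    rw [Pi.sub_apply, hfF i ⟨z, hCΩ hz⟩, hg ⟨z, hCΩ hz⟩]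
    exact h1
  refine ⟨g, fun x hx => ?_, hg⟩
  obtain ⟨ρ, hρ, hρΩ⟩ := Metric.isOpen_iff.1 hΩo _ hx
  set r : ℝ := ρ / 4 with hr
  have hr0 : 0 < r := by positivity
  set C : Set (Fin n → ℝ) := Metric.closedBall (fun k => (x k).im) (ρ / 2) with hC
  have hCc : IsCompact C := isCompact_closedBall _ _
  have hCΩ : C ⊆ Ω := (Metric.closedBall_subset_ball (half_lt_self hρ)).trans hρΩ
  have hball : ∀ y ∈ Metric.ball x r, ∀ w ∈ Metric.ball y r, w ∈ tube C := by
    intro y hy w hw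
    change (fun k => (w k).im) ∈ C
    rw [hC, Metric.mem_closedBall, dist_pi_le_iff (by positivity)]
    intro k
    have h1 : dist w x < ρ / 2 := by
      have := dist_triangle w y x
      rw [Metric.mem_ball] at hy hw
      linarith
    have h2 := (dist_le_pi_dist w x k).trans h1.le
    rw [dist_eq_norm] at h2
    rw [Real.dist_eq, ← Complex.sub_im]
    exact (Complex.abs_im_le_norm _).trans h2
  have hsub : ∀ y ∈ Metric.ball x r, Metric.ball y r ⊆ tube Ω := fun y hy w hw =>
    hCΩ (hball y hy w hw)
  have hdiff : ∀ i, ∀ y ∈ Metric.ball x r, HasFDerivAt (f i) (fderiv ℂ (f i) y) y := fun i y hy =>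
    ((hf i).differentiableAt ((isOpen_tube hΩo).mem_nhds
      (hsub y hy (Metric.mem_ball_self hr0)))).hasFDerivAt
  have hcauchy : UniformCauchySeqOn (fun i y => fderiv ℂ (f i) y) V (Metric.ball x r) := by
    intro u hu
    obtain ⟨ε, hε, hεu⟩ := Metric.mem_uniformity_dist.1 hu
    have h1 := hunif C hCc hCΩ (ε * r / 8) (by positivity)
    filter_upwards [h1.prod_mk h1] with ⟨i, j⟩ ⟨hi, hj⟩ y hy
    refine hεu ?_
    have hd : ∀ w ∈ Metric.ball y r, ‖(f i - f j) w‖ ≤ ε * r / 4 := by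
      intro w hw
      have h2 := hi w (hball y hy w hw)
      have h3 := hj w (hball y hy w hw)
      have h4 := norm_sub_le (f i w - g w) (f j w - g w)
      rw [sub_sub_sub_cancel_right] at h4
      rw [Pi.sub_apply]
      linarith
    have hy0 := Metric.mem_ball_self (x := y) hr0
    have h2 : ‖fderiv ℂ (f i - f j) y‖ ≤ (ε * r / 2) / r := by
      refine Complex.norm_fderiv_le_div_of_mapsTo_ball
        (((hf i).mono (hsub y hy)).sub ((hf j).mono (hsub y hy))) (fun w hw => ?_) hr0
      rw [mem_closedBall_iff_norm]
      refine (norm_sub_le _ _).trans ?_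
      linarith [hd w hw, hd y hy0]
    rw [fderiv_sub (hdiff i y hy).differentiableAt (hdiff j y hy).differentiableAt] at h2
    rw [dist_eq_norm]
    refine h2.trans_lt ?_
    have : ε * r / 2 / r = ε / 2 := by field_simp
    rw [this]
    exact half_lt_self hε
  have hlim : ∀ y ∈ Metric.ball x r, ∃ D, Tendsto (fun i => fderiv ℂ (f i) y) V (𝓝 D) :=
    fun y hy => cauchy_map_iff_exists_tendsto.1 (hcauchy.cauchy_map hy)
  choose! D hD using hlim
  have hpt : ∀ y ∈ Metric.ball x r, Tendsto (fun i => f i y) V (𝓝 (g y)) := by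
    intro y hy
    rw [Metric.tendsto_nhds]
    intro ε hε
    filter_upwards [hunif C hCc hCΩ (ε / 2) (half_pos hε)] with i hi
    rw [dist_eq_norm]
    exact (hi y (hball y hy y (Metric.mem_ball_self hr0))).trans_lt (half_lt_self hε)
  exact (hasFDerivAt_of_tendstoUniformlyOn Metric.isOpen_ball
    (hcauchy.tendstoUniformlyOn_of_tendsto hD) hdiff hpt
    (Metric.mem_ball_self hr0)).differentiableAt.differentiableWithinAt

theorem isAlmostPeriodic_of_tendsto_translateMap {F G : TubeMap Ω m} (hF : IsAlmostPeriodic F)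
    {V : Filter (Fin n → ℝ)} [NeBot V] (h : Tendsto (fun t => translateMap t F) V (𝓝 G)) :
    IsAlmostPeriodic G := by
  intro ε hε Ω' hΩ'
  have hcl : CompactlyIn (closure Ω') Ω := .of_isCompact hΩ'.1 hΩ'.2
  obtain ⟨b, hb, hbox⟩ := hF (ε / 2) (half_pos hε) (closure Ω') hcl
  obtain ⟨t, ht⟩ :=
    (tendsto_tubeMap_iff.1 h (closure Ω') hΩ'.1 hΩ'.2 (ε / 4) (by positivity)).exists
  refine ⟨b, hb, fun ξ => ?_⟩
  obtain ⟨τ, hτ, δ, hδ, hd⟩ := hbox ξ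
  refine ⟨τ, hτ, δ + ε / 2, by linarith, fun z hz l => ?_⟩
  have hz' : z ∈ subtube Ω (closure Ω') := subset_closure hz
  have h1 := ht z hz' l
  have h2 := ht (shift τ z) (shift_mem_subtube τ hz') l
  have h3 := hd (shift t z) (shift_mem_subtube t hz') l
  rw [shift_shift_comm] at h3
  change ‖component F l (shift t z) - component G l z‖ ≤ ε / 4 at h1
  change ‖component F l (shift t (shift τ z)) - component G l (shift τ z)‖ ≤ ε / 4 at h2
  calc ‖component G l (shift τ z) - component G l z‖
      = ‖(component F l (shift t (shift τ z)) - component F l (shift t z)) +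
          (component F l (shift t z) - component G l z) -
          (component F l (shift t (shift τ z)) - component G l (shift τ z))‖ := by
        congr 1; ring
    _ ≤ ‖component F l (shift t (shift τ z)) - component F l (shift t z)‖ +
          ‖component F l (shift t z) - component G l z‖ +
          ‖component F l (shift t (shift τ z)) - component G l (shift τ z)‖ :=
        (norm_sub_le _ _).trans (add_le_add_left (norm_add_le _ _) _)
    _ ≤ δ + ε / 2 := by linarith

/-- The perturbation of an exponential sum by `χ` multiplies its coefficients by `χ`. -/
theorem component_perturbExp (hΩ : Ω.Nonempty) (χ : AddChar (Fin n → ℝ) Circle)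
    {E : TubeMap Ω m} {l : Fin m} {c : (Fin n → ℝ) →₀ ℂ}
    (hE : component E l = fun z => expSum c z.1) (z : tube Ω) :
    component (perturbExp χ E) l z = expSum (modulate (fun μ => (χ μ : ℂ)) c) z.1 := by
  have hb : bohr (component E l) = c := by rw [hE, bohr_expSum hΩ]
  have hs : bohrSpectrum (component E l) = (c.support : Set (Fin n → ℝ)) := by
    ext μ
    simp [bohrSpectrum, hb]
  change (∑ᶠ (μ : Fin n → ℝ) (_ : μ ∈ bohrSpectrum (component E l)),
      bohr (component E l) μ * (χ μ : ℂ) * Complex.exp (Complex.I * pairing z.1 μ)) = _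
  rw [hs, hb, finsum_mem_coe_finset, expSum_modulate]
  exact Finset.sum_congr rfl fun μ _ => mul_assoc _ _ _

theorem component_perturbExp_bochnerFejer (hΩ : Ω.Nonempty) (χ : AddChar (Fin n → ℝ) Circle)
    {I : Set ℕ} (ω : I → (Fin n → ℝ)) (j : ℕ) (F : TubeMap Ω m) (l : Fin m) (z : tube Ω) :
    component (perturbExp χ (bochnerFejer ω j F)) l z =
      expSum (modulate (fun μ => (χ μ : ℂ))
        (modulate (bohr (component F l)) (fejerCoeff ω j))) z.1 :=
  component_perturbExp hΩ χ (E := bochnerFejer ω j F) (l := l) (fejerSum_eq_expSum ω j (component F l)) z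

/-- Let the phases of `t` converge to the character `χ` along `V`. Then the translates of `F`
converge along `V`, and the limit is the perturbation of `F` by `χ`: on a given subtube, both the
translates `F(· + t)` and the perturbed Bochner-Fejér sums are eventually close to the perturbation
of any exponential sum close to `F`. -/
theorem exists_isPerturbation_of_tendsto_phase (hΩ : Ω.Nonempty) (hΩo : IsOpen Ω)
    (hΩc : Convex ℝ Ω) (F : HAP Ω m) {χ : AddChar (Fin n → ℝ) Circle}
    {V : Filter (Fin n → ℝ)} [NeBot V]
    (hV : ∀ μ, Tendsto (fun t => phase t μ) V (𝓝 (χ μ))) :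
    ∃ G : HAP Ω m, Tendsto (fun t => translate t F) V (𝓝 G) ∧ IsPerturbation F χ G := by
  have hF := isHolomorphicAP_component F
  have happrox : ∀ C : Set (Fin n → ℝ), IsCompact C → C ⊆ Ω → ∀ ε : ℝ, 0 < ε →
      ∃ p : Fin m → (Fin n → ℝ) →₀ ℂ,
        (∀ l μ, bohr (component F.1 l) μ = 0 → p l μ = 0) ∧
        ∀ l, ∀ z ∈ subtube Ω C, ‖component F.1 l z - expSum (p l) z.1‖ ≤ ε := by
    intro C hC hCΩ ε hε
    choose p hp hnear using fun l => (hF l).exists_expSum_near le_rfl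
      ((hF l).hasCoeffs_bohr hΩ hΩo hΩc) hC hCΩ hε
    exact ⟨p, hp, hnear⟩
  have htrans : ∀ C : Set (Fin n → ℝ), IsCompact C → C ⊆ Ω → ∀ ε : ℝ, 0 < ε →
      ∀ p : Fin m → (Fin n → ℝ) →₀ ℂ,
        (∀ l, ∀ z ∈ subtube Ω C, ‖component F.1 l z - expSum (p l) z.1‖ ≤ ε) →
        ∀ᶠ t in V, ∀ z ∈ subtube Ω C, ∀ l, ‖component (translateMap t F.1) l z -
          expSum (modulate (fun μ => (χ μ : ℂ)) (p l)) z.1‖ ≤ 2 * ε := by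
    intro C hC hCΩ ε hε p hp
    have h1 : ∀ l, ∀ᶠ t in V, ∀ z ∈ tube C, ‖expSum (modulate (fun μ => (phase t μ : ℂ)) (p l) -
        modulate (fun μ => (χ μ : ℂ)) (p l)) z‖ ≤ ε := by
      intro l
      refine eventually_norm_expSum_le (S := (p l).support) (fun t μ hμ => ?_)
        (fun μ _ => ?_) hC hε
      · rw [Finsupp.sub_apply, modulate_apply, modulate_apply, Finsupp.notMem_support_iff.1 hμ]
        ring
      · simp only [Finsupp.sub_apply, modulate_apply]
        have h2 := (((continuous_subtype_val.tendsto (χ μ)).comp (hV μ)).const_mul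
          (p l μ)).sub_const (p l μ * (χ μ : ℂ))
        rwa [sub_self] at h2
    filter_upwards [eventually_all.2 h1] with t ht z hz l
    have h2 := hp l (shift t z) (shift_mem_subtube t hz)
    rw [coe_shift, expSum_add_ofReals] at h2
    have h3 := ht l z.1 hz
    rw [expSum_sub] at h3
    have h4 := norm_add_le _ _ |>.trans (add_le_add h2 h3)
    rw [sub_add_sub_cancel] at h4
    rw [two_mul]
    exact h4
  obtain ⟨G, hG⟩ : ∃ G : TubeMap Ω m, Tendsto (fun t => translateMap t F.1) V (𝓝 G) := by
    refine exists_tendsto_tubeMap fun C hC hCΩ ε hε => ?_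
    obtain ⟨p, -, hp⟩ := happrox C hC hCΩ (ε / 2) (half_pos hε)
    refine ⟨fun l z => expSum (modulate (fun μ => (χ μ : ℂ)) (p l)) z.1, ?_⟩
    have h1 := htrans C hC hCΩ (ε / 2) (half_pos hε) p hp
    rwa [mul_div_cancel₀ ε two_ne_zero] at h1
  refine ⟨⟨G, isHolomorphic_of_tendsto hΩo (fun t => isHolomorphic_translateMap t F.2.1) hG,
    isAlmostPeriodic_of_tendsto_translateMap F.2.2 hG⟩, tendsto_subtype_rng.2 hG, ?_⟩
  intro I _ ω
  have hli := linearIndependent_coe_basis ω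
  refine tendsto_tubeMap_iff.2 fun C hC hCΩ ε hε => ?_
  have hε5 : 0 < ε / 5 := by positivity
  obtain ⟨p, hp0, hp⟩ := happrox C hC hCΩ (ε / 5) hε5
  have hspan : ∀ l μ, p l μ ≠ 0 →
      μ ∈ Submodule.span ℚ (Set.range fun r => (ω r : Fin n → ℝ)) := by
    intro l μ hμ
    rw [span_range_coe_basis ω]
    exact Submodule.subset_span (Set.mem_iUnion.2 ⟨l, fun h => hμ (hp0 l μ h)⟩)
  have hfejer := fun l => (hF l).eventually_fejer_near hΩ hΩo hΩc hli hC hCΩ hε5 (hspan l) (hp l)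
  obtain ⟨t, ht1, ht2⟩ := ((htrans C hC hCΩ (ε / 5) hε5 p hp).and
    (tendsto_tubeMap_iff.1 hG C hC hCΩ (ε / 5) hε5)).exists
  filter_upwards [eventually_all.2 hfejer] with j hj z hz l
  rw [component_perturbExp_bochnerFejer hΩ]
  have h1 := norm_expSum_modulate_le χ (hj l) (z := z.1) hz
  rw [modulate_sub, expSum_sub] at h1
  have h2 := ht1 z hz l
  have h3 := ht2 z hz l
  set a := expSum (modulate (fun μ => (χ μ : ℂ))
    (modulate (bohr (component F.1 l)) (fejerCoeff (fun r => (ω r : Fin n → ℝ)) j))) z.1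
  set b := expSum (modulate (fun μ => (χ μ : ℂ)) (p l)) z.1
  set u := component (translateMap t F.1) l z
  calc ‖a - component G l z‖ = ‖(a - b) - (u - b) + (u - component G l z)‖ := by congr 1; ring
    _ ≤ ‖a - b‖ + ‖u - b‖ + ‖u - component G l z‖ :=
      (norm_add_le _ _).trans (add_le_add_left (norm_sub_le _ _) _)
    _ ≤ ε := by linarith

theorem exists_basis_spectralSpan (hΩ : Ω.Nonempty) (hΩo : IsOpen Ω) (hΩc : Convex ℝ Ω)
    (F : HAP Ω m) :
    ∃ I : Set ℕ, IsLowerSet I ∧ Nonempty (Module.Basis I ℚ (spectralSpan F.1)) :=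
  exists_basis_of_countable (Set.countable_iUnion fun l =>
    (isHolomorphicAP_component F l).countable_bohrSpectrum hΩ hΩo hΩc)

theorem IsPerturbation.unique (hΩ : Ω.Nonempty) (hΩo : IsOpen Ω) (hΩc : Convex ℝ Ω)
    {F : HAP Ω m} {χ : AddChar (Fin n → ℝ) Circle} {G G' : HAP Ω m} (h : IsPerturbation F χ G)
    (h' : IsPerturbation F χ G') : G = G' := by
  have := t2Space_tubeMap (Ω := Ω) (m := m)
  obtain ⟨I, hI, ⟨ω⟩⟩ := exists_basis_spectralSpan hΩ hΩo hΩc F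
  exact Subtype.ext (tendsto_nhds_unique (h I hI ω) (h' I hI ω))

end

end TubeAP

theorem theorem3p2 {n m : ℕ} (Ω : Set (Fin n → ℝ)) (hΩne : Ω.Nonempty) (hΩo : IsOpen Ω)
    (hΩc : Convex ℝ Ω) (F : TubeAP.HAP Ω m) :
    (∃ I : Set ℕ, IsLowerSet I ∧ Nonempty (Module.Basis I ℚ (TubeAP.spectralSpan F.1))) ∧
    (∀ χ : AddChar (Fin n → ℝ) Circle, ∃! G : TubeAP.HAP Ω m, TubeAP.IsPerturbation F χ G) ∧
    TubeAP.orbit F = closure (TubeAP.bochnerTransform F) := by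
  have hT2 := TubeAP.t2Space_tubeMap (Ω := Ω) (m := m)
  refine ⟨TubeAP.exists_basis_spectralSpan hΩne hΩo hΩc F, fun χ => ?_, Set.Subset.antisymm ?_ ?_⟩
  · obtain ⟨V, hV, hχ⟩ := TubeAP.exists_filter_tendsto_phase χ
    obtain ⟨G, -, hG⟩ := TubeAP.exists_isPerturbation_of_tendsto_phase hΩne hΩo hΩc F hχ
    exact ⟨G, hG, fun G' hG' => hG'.unique hΩne hΩo hΩc hG⟩
  · rintro G ⟨χ, hG⟩
    obtain ⟨V, hV, hχ⟩ := TubeAP.exists_filter_tendsto_phase χ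
    obtain ⟨G', hlim, hG'⟩ := TubeAP.exists_isPerturbation_of_tendsto_phase hΩne hΩo hΩc F hχ
    rw [hG.unique hΩne hΩo hΩc hG']
    exact mem_closure_of_tendsto hlim (Filter.Eventually.of_forall fun t => ⟨t, rfl⟩)
  · intro G hG
    -- an ultrafilter of translations along which `F` tends to `G`; the phases converge along it to
    -- some character, since the group of all characters is compact
    obtain ⟨U, hU, hUG⟩ := mem_closure_iff_ultrafilter.1 hG
    rw [TubeAP.bochnerTransform, ← Set.image_univ] at hU
    obtain ⟨W, rfl⟩ : ∃ W : Ultrafilter (Fin n → ℝ), W.map (fun t => TubeAP.translate t F) = U :=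
      ⟨U.ofComapInfPrincipal hU, Ultrafilter.ofComapInfPrincipal_eq_of_map hU⟩
    obtain ⟨χ, hχ⟩ := TubeAP.exists_addChar_tendsto W fun t => TubeAP.phase t
    obtain ⟨G', hlim, hG'⟩ := TubeAP.exists_isPerturbation_of_tendsto_phase hΩne hΩo hΩc F hχ
    have hGG' : G = G' := tendsto_nhds_unique hUG hlim
    exact ⟨χ, hGG' ▸ hG'⟩
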